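/- Let $d\ge 0$ be an integer and let $\alpha=(\alpha_1,\dots,\alpha_{d+1})\in\mathbb R^{d+1}$ be strictly increasing. **Trees.** Let $\mathscr T_n$ be the set of unlabeled plane rooted trees with $n+1$ leaves in which every internal (i.e. non-leaf) vertex has at least two children, and let $\mathscr T_{n,n}\subseteq\mathscr T_n$ be the subset of complete binary trees (those with $n$ internal vertices). Let $\mathcal K_d$ be the poset on $\mathscr T_{d+1}\cup\{\hat 0\}$ in which $\hat 0$ is the minimum and $T_1\le T_2$ for $T_1,T_2\in\mathscr T_{d+1}$ if and only if $T_2$ is obtained from $T_1$ by contracting (possibly no) internal edges, i.e. edges joining two internal vertices. Two trees in $\mathscr T_{n,n}$ differ by a *flip* if contracting an internal edge to a left child in one of them and an internal edge to a right child in the other gives the same tree. **Loday associahedron.** For $T\in\mathscr T_{d+1,d+1}$ and $1\le i\le d+1$ let $T_{(i)}$ be the subtree of $T$ rooted at the closest common ancestor of the $i$-th and $(i+1)$-st leaves (from left to right). For a complete binary tree $S$ with $t\ge1$ internal vertices whose left and right subtrees have $a$ and $b$ internal vertices, put $\operatorname{val}(\alpha,S)=\sum_{k=1}^t\alpha_k-\sum_{k=1}^a\alpha_k-\sum_{k=1}^b\alpha_k$.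 Let $v^\alpha_T=(\operatorname{val}(\alpha,T_{(1)}),\dots,\operatorname{val}(\alpha,T_{(d+1)}))$ and $$\mathrm{LodAsso}(\alpha)=\operatorname{ConvexHull}\{v_T^\alpha : T\in\mathscr T_{d+1,d+1}\}\subseteq\mathbb R^{d+1}.$$ **Polytopes.** A face of a polytope $P$ is the empty set or the set of maximizers over $P$ of a linear functional; the face poset of $P$ is the set of its faces ordered by inclusion. A *$d$-associahedron* is a $d$-dimensional polytope with a bijection between its vertices and $\mathscr T_{d+1,d+1}$ such that two distinct vertices form an edge if and only if the corresponding trees differ by a flip. For a polytope $P\subseteq\mathbb R^{d+1}$ on which the sum of the coordinates is constant, the normal cone at a nonempty face $F$ is the set of classes $w\in\mathbb R^{d+1}/\mathbb R(1,\dots,1)$ with $\langle w,y\rangle\ge\langle w,y'\rangle$ for all $y\in F$, $y'\in P$, and the normal fan of $P$ is the set of these cones for all nonempty faces $F$. A *generalized permutohedron* is a polytope $Q\subseteq\mathbb R^{d+1}$ with constant coordinate sum such that, for some strictly increasing $\beta\in\mathbb R^{d+1}$, every cone of the normal fan of $Q$ is a union of cones of the normal fan of the usual permutohedron $\operatorname{ConvexHull}\{(\beta_{\pi(1)},\dots,\beta_{\pi(d+1)})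 : \pi\in\mathfrak S_{d+1}\}$. **Theorem.** The face poset of $\mathrm{LodAsso}(\alpha)$ is isomorphic to $\mathcal K_d$. Moreover, $\mathrm{LodAsso}(\alpha)$ is a $d$-associahedron, and it is a generalized permutohedron. -/

import Mathlib

/-! ## Plane trees -/

/-- Unlabeled plane rooted trees: a tree is the ordered list of the subtrees at its root.
The one-vertex tree is `node []`. -/
inductive PlaneTree : Type
  | node (children : List PlaneTree) : PlaneTree

namespace PlaneTree

/-- Number of leaves (vertices without children). -/
def numLeaves : PlaneTree → ℕ
  | node cs => if cs.isEmpty then 1 else (cs.map numLeaves).sum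

/-- Number of internal vertices (vertices with at least one child). -/
def numInternal : PlaneTree → ℕ
  | node cs => if cs.isEmpty then 0 else 1 + (cs.map numInternal).sum

/-- Every internal vertex has at least two children. -/
inductive StrictlyBranching : PlaneTree → Prop
  | node (cs : List PlaneTree) (hcs : cs = [] ∨ 2 ≤ cs.length)
      (h : ∀ c ∈ cs, StrictlyBranching c) : StrictlyBranching (PlaneTree.node cs)

/-- `ContractsEdge j T S`: the tree `S` is obtained from `T` by contracting one internal edge
whose lower endpoint is the `j`-th child (counting from `0`) of its upper endpoint: the lower
endpoint, which is internal, is replaced by the list of its own children. -/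
inductive ContractsEdge : ℕ → PlaneTree → PlaneTree → Prop
  | root (l c r : List PlaneTree) (hc : c ≠ []) :
      ContractsEdge l.length (node (l ++ node c :: r)) (node (l ++ c ++ r))
  | deeper (j : ℕ) (l r : List PlaneTree) (t s : PlaneTree) (h : ContractsEdge j t s) :
      ContractsEdge j (node (l ++ t :: r)) (node (l ++ s :: r))

/-- `S` is obtained from `T` by contracting a (possibly empty) sequence of internal edges. -/
def ContractsTo : PlaneTree → PlaneTree → Prop :=
  Relation.ReflTransGen fun T S => ∃ j, ContractsEdge j T S

theorem ContractsEdge.numInternal_eq {j : ℕ} {T S : PlaneTree} (h : ContractsEdge j T S) :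
    T.numInternal = S.numInternal + 1 := by
  induction h with
  | root l c r hc =>
    have h1 : (l ++ c ++ r).isEmpty = false := by simp [hc]
    have h2 : c.isEmpty = false := by simp [hc]
    rw [numInternal, numInternal, h1]
    simp only [List.map_append, List.map_cons, List.sum_append, List.sum_cons]
    rw [numInternal, h2]
    simp
    omega
  | deeper j l r t s h ih =>
    rw [numInternal, numInternal]
    simp [ih]
    omega

theorem ContractsTo.eq_or_lt {T S : PlaneTree} (h : ContractsTo T S) :
    T = S ∨ S.numInternal < T.numInternal := by
  induction h with
  | refl => exact Or.inl rfl
  | tail _ hs ih =>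
    obtain ⟨j, hj⟩ := hs
    have := hj.numInternal_eq
    rcases ih with rfl | ih <;> right <;> omega

/-- `T.subtreeAt i` is the subtree of `T` rooted at the closest common ancestor of the leaves number
`i` and `i + 1`, where the leaves are numbered `0, 1, 2, …` from left to right (meaningful for
`i + 1 < T.numLeaves`): descend into the child that contains both leaves as long as there is one.
In `1`-based numbering this is the subtree rooted at the internal vertex with label `i + 1`. -/
def subtreeAt : PlaneTree → ℕ → PlaneTree
  | node cs, i => (go cs i).getD (node cs)
where
  /-- Search the given children from left to right for the one containing both leaves. -/
  go : List PlaneTree → ℕ → Option PlaneTree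
    | [], _ => none
    | c :: cs, i =>
      if c.numLeaves ≤ i then go cs (i - c.numLeaves)
      else if i + 1 < c.numLeaves then some (c.subtreeAt i)
      else none

end PlaneTree

/-- Strictly branching plane trees with `n + 1` leaves. -/
def SBTree (n : ℕ) : Type :=
  {T : PlaneTree // T.StrictlyBranching ∧ T.numLeaves = n + 1}

/-- `T₁ ≤ T₂` when `T₂` is obtained from `T₁` by contracting internal edges. -/
instance (n : ℕ) : PartialOrder (SBTree n) where
  le T₁ T₂ := T₁.1.ContractsTo T₂.1
  le_refl _ := Relation.ReflTransGen.refl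
  le_trans _ _ _ h₁ h₂ := Relation.ReflTransGen.trans h₁ h₂
  le_antisymm T₁ T₂ h₁ h₂ := by
    rcases PlaneTree.ContractsTo.eq_or_lt h₁ with h | h
    · exact Subtype.ext h
    · rcases PlaneTree.ContractsTo.eq_or_lt h₂ with h' | h'
      · exact Subtype.ext h'.symm
      · omega

/-- The poset `𝒦_d`: strictly branching plane trees with `d + 2` leaves, ordered by contraction of
internal edges, together with an extra minimum. -/
abbrev AssoPoset (d : ℕ) : Type := WithBot (SBTree (d + 1))

/-- Complete binary trees with `n + 1` leaves, that is, the strictly branching plane trees with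
`n + 1` leaves and `n` internal vertices. -/
def CBTree (n : ℕ) : Type := {T : SBTree n // T.1.numInternal = n}

/-- `T` and `T'` differ by a flip: contracting a Left internal edge in one of them and a Right
internal edge in the other one gives the same tree. -/
def CBTree.Flip {n : ℕ} (T T' : CBTree n) : Prop :=
  ∃ S : PlaneTree,
    (PlaneTree.ContractsEdge 0 T.1.1 S ∧ PlaneTree.ContractsEdge 1 T'.1.1 S) ∨
    (PlaneTree.ContractsEdge 1 T.1.1 S ∧ PlaneTree.ContractsEdge 0 T'.1.1 S)

/-! ## The Loday associahedron -/

/-- `α₁ + ⋯ + α_t`, the sum of the first `t` entries of `α`. -/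
noncomputable def initialSum {n : ℕ} (α : Fin n → ℝ) (t : ℕ) : ℝ :=
  ∑ k : Fin n with k.val < t, α k

/-- `val(α, T)` for a complete binary tree `T` with at least one internal vertex; the value is
irrelevant on other trees. -/
noncomputable def treeVal {n : ℕ} (α : Fin n → ℝ) : PlaneTree → ℝ
  | .node [L, R] =>
      initialSum α (PlaneTree.node [L, R]).numInternal
        - initialSum α L.numInternal - initialSum α R.numInternal
  | _ => 0

/-- The point `v_T^α`. -/
noncomputable def lodayVertex {n : ℕ} (α : Fin n → ℝ) (T : CBTree n) : Fin n → ℝ :=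
  fun i => treeVal α (T.1.1.subtreeAt i.val)

/-- The Loday associahedron of `α`. -/
def LodAsso {n : ℕ} (α : Fin n → ℝ) : Set (Fin n → ℝ) :=
  convexHull ℝ (Set.range (lodayVertex α))

/-! ## Polytopes, faces, normal fans -/

/-- A polytope in `ℝⁿ`. -/
def IsPolytope {n : ℕ} (P : Set (Fin n → ℝ)) : Prop :=
  ∃ s : Set (Fin n → ℝ), s.Finite ∧ P = convexHull ℝ s

/-- The face poset: all faces of `P`, ordered by inclusion. `IsExposed ℝ P F` says that `F` is empty
or the set of maximizers over `P` of some linear functional. -/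
abbrev FacePoset {n : ℕ} (P : Set (Fin n → ℝ)) : Type :=
  {F : Set (Fin n → ℝ) // IsExposed ℝ P F}

/-- A `d`-associahedron: a `d`-dimensional polytope whose vertices are in bijection with the complete
binary trees with `d + 2` leaves, in such a way that two (different) vertices span an edge if and
only if the corresponding trees differ by a flip. -/
def IsAssociahedron {n : ℕ} (d : ℕ) (P : Set (Fin n → ℝ)) : Prop :=
  IsPolytope P ∧ Module.finrank ℝ (vectorSpan ℝ P) = d ∧
    ∃ e : CBTree (d + 1) ≃ P.exposedPoints ℝ, ∀ T T' : CBTree (d + 1), T ≠ T' →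
      (IsExposed ℝ P (segment ℝ (e T : Fin n → ℝ) (e T')) ↔ T.Flip T')

/-- The quotient of `ℝⁿ` by the line spanned by `(1, …, 1)`. Through the dot product it is the dual of
the space of vectors with coordinate sum `0`. -/
abbrev OneQuotient (n : ℕ) : Type :=
  (Fin n → ℝ) ⧸ Submodule.span ℝ {(1 : Fin n → ℝ)}

/-- The normal cone of `P` at `F`, for `F ⊆ P` where the coordinate sum is constant on `P`: the classes
of all `w` whose dot product with points of `P` is maximal at all points of `F`. (The condition then
depends only on the class of `w`.) -/
def normalCone {n : ℕ} (F P : Set (Fin n → ℝ)) : Set (OneQuotient n) :=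
  (Submodule.span ℝ {(1 : Fin n → ℝ)}).mkQ ''
    {w | ∀ y ∈ F, ∀ y' ∈ P, w ⬝ᵥ y' ≤ w ⬝ᵥ y}

/-- The normal fan: the normal cones at all nonempty faces. -/
def normalFan {n : ℕ} (P : Set (Fin n → ℝ)) : Set (Set (OneQuotient n)) :=
  {C | ∃ F : Set (Fin n → ℝ), IsExposed ℝ P F ∧ F.Nonempty ∧ C = normalCone F P}

/-- `Q` is a deformation of `P`: every cone in the normal fan of `Q` is a union of cones in the normal
fan of `P`. -/
def IsDeformation {n : ℕ} (Q P : Set (Fin n → ℝ)) : Prop :=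
  ∀ C ∈ normalFan Q, ∃ 𝒮 ⊆ normalFan P, C = ⋃₀ 𝒮

/-- The usual permutohedron of `β`. -/
def Permutohedron {n : ℕ} (β : Fin n → ℝ) : Set (Fin n → ℝ) :=
  convexHull ℝ (Set.range fun π : Equiv.Perm (Fin n) => fun i => β (π i))

/-- A generalized permutohedron: a polytope in a translate of the space of vectors with coordinate sum
`0` that is a deformation of some usual permutohedron. -/
def IsGeneralizedPermutohedron {n : ℕ} (Q : Set (Fin n → ℝ)) : Prop :=
  IsPolytope Q ∧ (∃ c : ℝ, ∀ x ∈ Q, ∑ i, x i = c) ∧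
    ∃ β : Fin n → ℝ, StrictMono β ∧ IsDeformation Q (Permutohedron β)

/-
Number the leaves of a strictly branching tree `T` by `0, …, n`. An internal vertex with the leaves
`a, …, b` below it is recorded as the bracket `(a, b)`. The tree is determined by its brackets, and
`S` arises from `T` by contracting edges if and only if every bracket of `S` is a bracket of `T`.

If `T` is binary, then the coordinates `a, …, b - 1` of `v_T^α` sum to at least
`α₁ + ⋯ + α_(b - a)`, with equality exactly when `(a, b)` is a bracket of `T`: because `α` is
increasing, `α₁ + ⋯ + α_(x + y + 1) - (α₁ + ⋯ + α_x) - (α₁ + ⋯ + α_y)` is increasing in `x` and `y`.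
Hence the vertices `v_U^α` with `U ≤ T` are those that minimize all the sums belonging to brackets
of `T`.

A linear functional `w` on `ℝⁿ` determines a tree: the Cartesian tree that splits `{0, …, n}` at
all positions where `w` is maximal, and then recursively each of the pieces. Summation by parts
along this tree writes `⟨w, y⟩`, up to the constant coming from the total coordinate sum, as a
combination of the bracket sums of `y` with negative coefficients. So the face of the Loday
associahedron in direction `w` is spanned by the `v_U^α` with `U` below the Cartesian tree of `w`.
Every strictly branching tree is the Cartesian tree of some `w`, which gives the face poset. The
Cartesian tree only depends on the relative order of the coordinates of `w`, which makes the normal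
fan coarser than the braid fan.
-/

namespace PlaneTree

/-! ## Brackets of a forest -/

theorem forest_induction {P : List PlaneTree → Prop} (nil : P [])
    (cons : ∀ cs ds, P cs → P ds → P (node cs :: ds)) (F : List PlaneTree) : P F :=
  PlaneTree.rec_1 (motive_1 := fun t => ∀ ds, P ds → P (t :: ds)) (motive_2 := P)
    (fun cs hcs ds hds => cons cs ds hcs hds) nil (fun _ ts ht hts => ht ts hts) F

/-- The total number of leaves of a forest. -/
def leaves (F : List PlaneTree) : ℕ := (F.map numLeaves).sum

@[simp] theorem leaves_nil : leaves [] = 0 := rfl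

@[simp] theorem leaves_cons (t : PlaneTree) (F : List PlaneTree) :
    leaves (t :: F) = t.numLeaves + leaves F := by simp [leaves]

@[simp] theorem leaves_append (F G : List PlaneTree) :
    leaves (F ++ G) = leaves F + leaves G := by simp [leaves]

@[simp] theorem numLeaves_leaf : (node []).numLeaves = 1 := by simp [numLeaves]

theorem numLeaves_node {cs : List PlaneTree} (hcs : cs ≠ []) :
    (node cs).numLeaves = leaves cs := by
  simp [numLeaves, hcs, leaves]

theorem length_le_leaves (F : List PlaneTree) : F.length ≤ leaves F := by
  induction F using forest_induction with
  | nil => simp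
  | cons cs ds hcs hds =>
    rcases eq_or_ne cs [] with rfl | hne
    · simp only [List.length_cons, leaves_cons, numLeaves_leaf]; omega
    · have := List.length_pos_iff.mpr hne
      simp only [List.length_cons, leaves_cons, numLeaves_node hne]; omega

theorem numLeaves_pos (t : PlaneTree) : 0 < t.numLeaves :=
  Nat.succ_le_iff.mp (by simpa using length_le_leaves [t])

theorem strictlyBranching_node_iff {cs : List PlaneTree} :
    (node cs).StrictlyBranching ↔
      (cs = [] ∨ 2 ≤ cs.length) ∧ ∀ c ∈ cs, c.StrictlyBranching :=
  ⟨fun ⟨_, hlen, hcs⟩ => ⟨hlen, hcs⟩, fun ⟨hlen, hcs⟩ => .node cs hlen hcs⟩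

/-- `IsBracket F o a b`: when the leaves of the forest `F` are numbered from left to right starting
with `o`, some internal vertex of `F` has exactly the leaves `a, …, b` below it. -/
def IsBracket : List PlaneTree → ℕ → ℕ → ℕ → Prop
  | [], _, _, _ => False
  | node cs :: ds, o, a, b =>
    (cs ≠ [] ∧ a = o ∧ b + 1 = o + leaves cs) ∨ IsBracket cs o a b ∨
      IsBracket ds (o + (node cs).numLeaves) a b
termination_by F => sizeOf F
decreasing_by all_goals simp_wf <;> omega

@[simp] theorem isBracket_nil (o a b : ℕ) : IsBracket [] o a b ↔ False := by rw [IsBracket]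

theorem isBracket_cons_node (cs ds : List PlaneTree) (o a b : ℕ) :
    IsBracket (node cs :: ds) o a b ↔
      (cs ≠ [] ∧ a = o ∧ b + 1 = o + leaves cs) ∨ IsBracket cs o a b ∨
        IsBracket ds (o + (node cs).numLeaves) a b := by rw [IsBracket]

theorem isBracket_singleton (cs : List PlaneTree) (o a b : ℕ) :
    IsBracket [node cs] o a b ↔
      (cs ≠ [] ∧ a = o ∧ b + 1 = o + leaves cs) ∨ IsBracket cs o a b := by
  simp [isBracket_cons_node]

theorem isBracket_cons (t : PlaneTree) (ds : List PlaneTree) (o a b : ℕ) :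
    IsBracket (t :: ds) o a b ↔ IsBracket [t] o a b ∨ IsBracket ds (o + t.numLeaves) a b := by
  obtain ⟨cs⟩ := t
  rw [isBracket_cons_node, isBracket_singleton, or_assoc]

theorem isBracket_append (F G : List PlaneTree) (o a b : ℕ) :
    IsBracket (F ++ G) o a b ↔ IsBracket F o a b ∨ IsBracket G (o + leaves F) a b := by
  induction F generalizing o with
  | nil => simp
  | cons t F ih =>
    rw [List.cons_append, isBracket_cons, ih, isBracket_cons t F, or_assoc, leaves_cons, add_assoc]

theorem isBracket_add_right (F : List PlaneTree) (o a b k : ℕ) :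
    IsBracket F (o + k) (a + k) (b + k) ↔ IsBracket F o a b := by
  induction F using forest_induction generalizing o with
  | nil => simp
  | cons cs ds hcs hds =>
    rw [isBracket_cons_node, isBracket_cons_node, hcs, add_right_comm o k (numLeaves _), hds]
    have : b + k + 1 = o + k + leaves cs ↔ b + 1 = o + leaves cs := by omega
    rw [this, add_left_inj]

theorem IsBracket.bounds {F : List PlaneTree} {o a b : ℕ} (h : IsBracket F o a b)
    (hF : ∀ t ∈ F, t.StrictlyBranching) : o ≤ a ∧ a < b ∧ b < o + leaves F := by
  induction F using forest_induction generalizing o with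
  | nil => simp at h
  | cons cs ds ih_cs ih_ds =>
    simp only [List.mem_cons, forall_eq_or_imp, strictlyBranching_node_iff] at hF
    obtain ⟨⟨hlen, hcs⟩, hds⟩ := hF
    rw [isBracket_cons_node] at h
    rw [leaves_cons]
    have := length_le_leaves cs
    rcases h with ⟨hne, rfl, hb⟩ | h | h
    · have := hlen.resolve_left hne
      rw [numLeaves_node hne]; omega
    · have hne : cs ≠ [] := by rintro rfl; simp at h
      have := ih_cs h hcs
      rw [numLeaves_node hne]; omega
    · have := ih_ds h hds
      omega

theorem IsBracket.bounds_singleton {t : PlaneTree} {o a b : ℕ} (h : IsBracket [t] o a b)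
    (ht : t.StrictlyBranching) : o ≤ a ∧ a < b ∧ b < o + t.numLeaves := by
  simpa using h.bounds (by simpa using ht)

theorem IsBracket.ne_of_children {cs : List PlaneTree} {o a b : ℕ} (h : IsBracket cs o a b)
    (hcs : (node cs).StrictlyBranching) : ¬ (a = o ∧ b + 1 = o + leaves cs) := by
  rintro ⟨rfl, hb⟩
  obtain ⟨hlen, hcs⟩ := strictlyBranching_node_iff.mp hcs
  match cs, hlen with
  | [], _ => simp at h
  | t :: t' :: r, _ =>
    have := numLeaves_pos t
    have := numLeaves_pos t'
    simp only [leaves_cons] at hb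
    rcases (isBracket_cons _ _ _ _ _).mp h with h | h
    · have := h.bounds_singleton (hcs t (by simp))
      omega
    · have := h.bounds fun x hx => hcs x (List.mem_cons_of_mem _ hx)
      omega

/-! ## Contractions and brackets -/

theorem ContractsEdge.numLeaves_eq {j : ℕ} {T S : PlaneTree} (h : ContractsEdge j T S) :
    T.numLeaves = S.numLeaves := by
  induction h with
  | root l c r hc =>
    rw [numLeaves_node (by simp), numLeaves_node (by simp [hc])]
    simp only [leaves_append, leaves_cons, numLeaves_node hc, add_assoc]
  | deeper j l r t s _ ih =>
    rw [numLeaves_node (by simp), numLeaves_node (by simp)]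
    simp only [leaves_append, leaves_cons, ih]

theorem ContractsEdge.isBracket {j : ℕ} {T S : PlaneTree} (h : ContractsEdge j T S)
    {o a b : ℕ} (hS : IsBracket [S] o a b) : IsBracket [T] o a b := by
  induction h generalizing o with
  | root l c r hc =>
    rw [isBracket_singleton, isBracket_append, isBracket_append] at hS
    rw [isBracket_singleton, isBracket_append, isBracket_cons_node, numLeaves_node hc]
    simp only [leaves_append, leaves_cons, numLeaves_node hc, ← add_assoc] at hS ⊢
    have : l ++ node c :: r ≠ [] := by simp
    tauto
  | deeper j l r t s h ih =>
    rw [isBracket_singleton, isBracket_append, isBracket_cons] at hS ⊢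
    simp only [leaves_append, leaves_cons, h.numLeaves_eq] at hS ⊢
    have := @ih (o + leaves l)
    have : l ++ t :: r ≠ [] := by simp
    tauto

theorem ContractsEdge.strictlyBranching {j : ℕ} {T S : PlaneTree} (h : ContractsEdge j T S)
    (hT : T.StrictlyBranching) : S.StrictlyBranching := by
  induction h with
  | root l c r hc =>
    obtain ⟨-, hcs⟩ := strictlyBranching_node_iff.mp hT
    obtain ⟨hlen, hc'⟩ := strictlyBranching_node_iff.mp (hcs (node c) (by simp))
    have := hlen.resolve_left hc
    refine strictlyBranching_node_iff.mpr ⟨Or.inr ?_, ?_⟩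
    · simp only [List.length_append]; omega
    · simp only [List.mem_append, List.mem_cons] at hcs ⊢
      rintro x ((hx | hx) | hx)
      exacts [hcs x (.inl hx), hc' x hx, hcs x (.inr (.inr hx))]
  | deeper j l r t s _ ih =>
    obtain ⟨hlen, hcs⟩ := strictlyBranching_node_iff.mp hT
    refine strictlyBranching_node_iff.mpr ⟨by simpa using hlen, ?_⟩
    simp only [List.mem_append, List.mem_cons] at hcs ⊢
    rintro x (hx | rfl | hx)
    exacts [hcs x (.inl hx), ih (hcs t (.inr (.inl rfl))), hcs x (.inr (.inr hx))]

theorem ContractsTo.numLeaves_eq {T S : PlaneTree} (h : ContractsTo T S) :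
    T.numLeaves = S.numLeaves := by
  induction h with
  | refl => rfl
  | tail _ hedge ih => exact ih.trans hedge.choose_spec.numLeaves_eq

theorem ContractsTo.isBracket {T S : PlaneTree} (h : ContractsTo T S) {o a b : ℕ}
    (hS : IsBracket [S] o a b) : IsBracket [T] o a b := by
  induction h with
  | refl => exact hS
  | tail _ hedge ih => exact ih (hedge.choose_spec.isBracket hS)

theorem ContractsTo.deeper {t s : PlaneTree} (l r : List PlaneTree) (h : ContractsTo t s) :
    ContractsTo (node (l ++ t :: r)) (node (l ++ s :: r)) :=
  Relation.ReflTransGen.lift (fun t => node (l ++ t :: r))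
    (fun _ _ ⟨j, hj⟩ => ⟨j, .deeper j l r _ _ hj⟩) _ _ h

theorem ContractsEdge.append_left {j : ℕ} {F G : List PlaneTree} (l : List PlaneTree)
    (h : ContractsEdge j (node F) (node G)) :
    ∃ j, ContractsEdge j (node (l ++ F)) (node (l ++ G)) := by
  cases h with
  | root l' c r hc =>
    exact ⟨(l ++ l').length, by simpa using ContractsEdge.root (l ++ l') c r hc⟩
  | deeper _ l' r t s h =>
    exact ⟨j, by simpa using ContractsEdge.deeper j (l ++ l') r _ _ h⟩

theorem ContractsTo.append_left {F G : List PlaneTree} (l : List PlaneTree)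
    (h : ContractsTo (node F) (node G)) : ContractsTo (node (l ++ F)) (node (l ++ G)) := by
  let prepend : PlaneTree → PlaneTree := fun | node F => node (l ++ F)
  have hprepend : ∀ T S, (∃ j, ContractsEdge j T S) →
      ∃ j, ContractsEdge j (prepend T) (prepend S) :=
    fun | node _, node _, ⟨_, hj⟩ => hj.append_left l
  exact Relation.ReflTransGen.lift prepend hprepend _ _ h

/-- The forest `F` refines `G`: every bracket of `G` is a bracket of `F`, if the leaves of both
forests are numbered starting with `o`. -/
def Refines (o : ℕ) (F G : List PlaneTree) : Prop :=
  ∀ a b, IsBracket G o a b → IsBracket F o a b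

section Refines

variable {o : ℕ} {T S : PlaneTree} {as bs cs ds : List PlaneTree}

theorem Refines.numLeaves_head_le (h : Refines o (T :: bs) (S :: ds))
    (hF : ∀ t ∈ T :: bs, t.StrictlyBranching) : S.numLeaves ≤ T.numLeaves := by
  obtain ⟨cs⟩ := S
  rcases eq_or_ne cs [] with rfl | hne
  · simpa using Nat.succ_le_iff.mpr T.numLeaves_pos
  have hpos := numLeaves_pos (node cs)
  have hroot : IsBracket (T :: bs) o o (o + (node cs).numLeaves - 1) := by
    refine h _ _ ((isBracket_cons_node _ _ _ _ _).mpr (Or.inl ⟨hne, rfl, ?_⟩))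
    rw [← numLeaves_node hne]; omega
  simp only [List.mem_cons, forall_eq_or_imp] at hF
  rcases (isBracket_cons _ _ _ _ _).mp hroot with hroot | hroot
  · have := hroot.bounds_singleton hF.1
    omega
  · have := hroot.bounds hF.2
    have := T.numLeaves_pos
    omega

theorem Refines.head (h : Refines o (T :: bs) (S :: ds)) (hST : T.numLeaves = S.numLeaves)
    (hbs : ∀ t ∈ bs, t.StrictlyBranching) (hS : S.StrictlyBranching) : Refines o [T] [S] := by
  intro a b hab
  refine ((isBracket_cons _ _ _ _ _).mp
    (h a b ((isBracket_cons _ _ _ _ _).mpr (Or.inl hab)))).resolve_right fun hab' => ?_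
  have := hab.bounds_singleton hS
  have := hab'.bounds hbs
  omega

theorem Refines.tail (h : Refines o (T :: bs) (S :: ds)) (hST : T.numLeaves = S.numLeaves)
    (hT : T.StrictlyBranching) (hds : ∀ t ∈ ds, t.StrictlyBranching) :
    Refines (o + T.numLeaves) bs ds := by
  intro a b hab
  rw [hST] at hab
  refine ((isBracket_cons _ _ _ _ _).mp
    (h a b ((isBracket_cons _ _ _ _ _).mpr (Or.inr hab)))).resolve_left fun hab' => ?_
  have := hab.bounds hds
  have := hab'.bounds_singleton hT
  omega

theorem Refines.children (h : Refines o [node as] [node cs])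
    (hl : (node as).numLeaves = (node cs).numLeaves) (hS : (node cs).StrictlyBranching) :
    Refines o as cs := by
  intro a b hab
  have hcs : cs ≠ [] := by rintro rfl; simp at hab
  refine ((isBracket_singleton _ _ _ _).mp
    (h a b ((isBracket_singleton _ _ _ _).mpr (Or.inr hab)))).resolve_left ?_
  rintro ⟨has, ha, hb⟩
  rw [numLeaves_node has, numLeaves_node hcs] at hl
  exact hab.ne_of_children hS ⟨ha, hl ▸ hb⟩

theorem Refines.contract_head (h : Refines o (node as :: bs) (S :: ds)) (has : as ≠ [])
    (hlt : S.numLeaves < (node as).numLeaves) (hG : ∀ t ∈ S :: ds, t.StrictlyBranching) :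
    Refines o (as ++ bs) (S :: ds) := by
  intro a b hab
  have hab' := h a b hab
  rw [isBracket_cons_node, numLeaves_node has] at hab'
  rw [isBracket_append]
  refine hab'.resolve_left ?_
  rintro ⟨-, rfl, hb⟩
  rw [numLeaves_node has] at hlt
  simp only [List.mem_cons, forall_eq_or_imp] at hG
  rcases (isBracket_cons _ _ _ _ _).mp hab with hab | hab
  · have := hab.bounds_singleton hG.1
    omega
  · have := hab.bounds hG.2
    have := S.numLeaves_pos
    omega

end Refines

theorem sizeOf_append_le (F G : List PlaneTree) : sizeOf (F ++ G) ≤ sizeOf F + sizeOf G := by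
  induction F with
  | nil => simp
  | cons t F ih => simp only [List.cons_append, List.cons.sizeOf_spec]; omega

theorem leaves_children {cs : List PlaneTree} (hT : (node cs).StrictlyBranching) :
    leaves cs = if (node cs).numLeaves = 1 then 0 else (node cs).numLeaves := by
  rcases eq_or_ne cs [] with rfl | hne
  · simp
  · have := (strictlyBranching_node_iff.mp hT).1.resolve_left hne
    have := length_le_leaves cs
    rw [numLeaves_node hne, if_neg (by omega)]

theorem leaves_children_inj {as cs : List PlaneTree} (hT : (node as).StrictlyBranching)
    (hS : (node cs).StrictlyBranching) (hl : (node as).numLeaves = (node cs).numLeaves) :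
    leaves as = leaves cs := by
  rw [leaves_children hT, leaves_children hS, hl]

theorem contractsTo_of_refines (o : ℕ) (F G : List PlaneTree)
    (hF : ∀ t ∈ F, t.StrictlyBranching) (hG : ∀ t ∈ G, t.StrictlyBranching)
    (hl : leaves F = leaves G) (h : Refines o F G) : ContractsTo (node F) (node G) := by
  match F, G with
  | [], [] => exact .refl
  | [], S :: _ => have := S.numLeaves_pos; simp only [leaves_nil, leaves_cons] at hl; omega
  | T :: _, [] => have := T.numLeaves_pos; simp only [leaves_nil, leaves_cons] at hl; omega
  | node as :: bs, node cs :: ds =>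
    have hle := h.numLeaves_head_le hF
    have ⟨hA, hbs⟩ := List.forall_mem_cons.mp hF
    have ⟨hC, hds⟩ := List.forall_mem_cons.mp hG
    have has := (strictlyBranching_node_iff.mp hA).2
    have hcs := (strictlyBranching_node_iff.mp hC).2
    simp only [leaves_cons] at hl
    rcases hle.eq_or_lt with heq | hlt
    · have hhead := contractsTo_of_refines o as cs has hcs (leaves_children_inj hA hC heq.symm)
        ((h.head heq.symm hbs hC).children heq.symm hC)
      have htail := contractsTo_of_refines (o + (node as).numLeaves) bs ds hbs hds (by omega)
        (h.tail heq.symm hA hds)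
      exact (hhead.deeper [] bs).trans (htail.append_left [node cs])
    · have hne : as ≠ [] := by
        rintro rfl
        have := numLeaves_pos (node cs)
        simp only [numLeaves_leaf] at hlt; omega
      refine .head ⟨_, .root [] as bs hne⟩ (contractsTo_of_refines o (as ++ bs) (node cs :: ds)
        (List.forall_mem_append.mpr ⟨has, hbs⟩) hG ?_ (h.contract_head hne hlt hG))
      simpa [numLeaves_node hne] using hl
termination_by sizeOf F + sizeOf G
decreasing_by
  all_goals
    have := sizeOf_append_le as bs
    simp_all only [List.cons.sizeOf_spec, node.sizeOf_spec]
    omega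

theorem contractsTo_iff {T S : PlaneTree} (hT : T.StrictlyBranching) (hS : S.StrictlyBranching)
    (hl : T.numLeaves = S.numLeaves) :
    ContractsTo T S ↔ ∀ a b, IsBracket [S] 0 a b → IsBracket [T] 0 a b := by
  refine ⟨fun h a b => h.isBracket, fun h => ?_⟩
  obtain ⟨as⟩ := T
  obtain ⟨cs⟩ := S
  exact contractsTo_of_refines 0 as cs (strictlyBranching_node_iff.mp hT).2
    (strictlyBranching_node_iff.mp hS).2 (leaves_children_inj hT hS hl) (Refines.children h hl hS)

/-! ## Complete binary trees and flips -/

/-- Complete binary trees: every internal vertex has exactly two children. -/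
inductive IsBinary : PlaneTree → Prop
  | leaf : IsBinary (node [])
  | node (L R : PlaneTree) (hL : IsBinary L) (hR : IsBinary R) : IsBinary (node [L, R])

theorem numLeaves_pair (L R : PlaneTree) :
    (node [L, R]).numLeaves = L.numLeaves + R.numLeaves := by
  simp [numLeaves_node]

theorem numInternal_leaf : (node []).numInternal = 0 := by simp [numInternal]

theorem numInternal_node {cs : List PlaneTree} (hcs : cs ≠ []) :
    (node cs).numInternal = 1 + (cs.map numInternal).sum := by
  simp [numInternal, hcs]

theorem isBinary_pair_iff {L R : PlaneTree} :
    (PlaneTree.node [L, R]).IsBinary ↔ L.IsBinary ∧ R.IsBinary :=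
  ⟨fun | .node _ _ hL hR => ⟨hL, hR⟩, fun ⟨hL, hR⟩ => .node L R hL hR⟩

theorem IsBinary.strictlyBranching {T : PlaneTree} (h : T.IsBinary) : T.StrictlyBranching := by
  induction h with
  | leaf => exact strictlyBranching_node_iff.mpr (by simp)
  | node L R _ _ hL hR => exact strictlyBranching_node_iff.mpr (by simp [hL, hR])

theorem IsBinary.numInternal_add_one {T : PlaneTree} (h : T.IsBinary) :
    T.numInternal + 1 = T.numLeaves := by
  induction h with
  | leaf => simp [numInternal_leaf]
  | node L R _ _ hL hR =>
    rw [numLeaves_pair, numInternal_node (by simp)]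
    simp only [List.map_cons, List.map_nil, List.sum_cons, List.sum_nil]
    omega

theorem sum_numInternal_add_length_le {F : List PlaneTree} (hF : ∀ t ∈ F, t.StrictlyBranching) :
    (F.map numInternal).sum + F.length ≤ leaves F := by
  induction F using forest_induction with
  | nil => simp
  | cons cs ds ih_cs ih_ds =>
    obtain ⟨hT, hds⟩ := List.forall_mem_cons.mp hF
    obtain ⟨hlen, hcs⟩ := strictlyBranching_node_iff.mp hT
    have := ih_ds hds
    simp only [List.map_cons, List.sum_cons, List.length_cons, leaves_cons]
    rcases eq_or_ne cs [] with rfl | hne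
    · rw [numInternal_leaf, numLeaves_leaf]; omega
    · have := ih_cs hcs
      have := hlen.resolve_left hne
      rw [numInternal_node hne, numLeaves_node hne]; omega

theorem isBinary_of_sum_numInternal {F : List PlaneTree} (hF : ∀ t ∈ F, t.StrictlyBranching)
    (hsum : (F.map numInternal).sum + F.length = leaves F) : ∀ t ∈ F, t.IsBinary := by
  induction F using forest_induction with
  | nil => simp
  | cons cs ds ih_cs ih_ds =>
    obtain ⟨hT, hds⟩ := List.forall_mem_cons.mp hF
    obtain ⟨hlen, hcs⟩ := strictlyBranching_node_iff.mp hT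
    have := sum_numInternal_add_length_le hds
    simp only [List.map_cons, List.sum_cons, List.length_cons, leaves_cons] at hsum
    rcases eq_or_ne cs [] with rfl | hne
    · rw [numInternal_leaf, numLeaves_leaf] at hsum
      exact List.forall_mem_cons.mpr ⟨.leaf, ih_ds hds (by omega)⟩
    · have := sum_numInternal_add_length_le hcs
      have := hlen.resolve_left hne
      rw [numInternal_node hne, numLeaves_node hne] at hsum
      obtain ⟨L, R, rfl⟩ := List.length_eq_two.mp (show cs.length = 2 by omega)
      have hLR := ih_cs hcs (by omega)
      exact List.forall_mem_cons.mpr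
        ⟨.node L R (hLR L (by simp)) (hLR R (by simp)), ih_ds hds (by omega)⟩

theorem isBinary_iff {T : PlaneTree} :
    T.IsBinary ↔ T.StrictlyBranching ∧ T.numInternal + 1 = T.numLeaves :=
  ⟨fun h => ⟨h.strictlyBranching, h.numInternal_add_one⟩, fun ⟨hT, h⟩ =>
    isBinary_of_sum_numInternal (F := [T]) (by simpa using hT) (by simpa using h) T (by simp)⟩

/-- `IsFlip T T' S`: the binary trees `T` and `T'` become the tree `S` when an edge to a left child
is contracted in `T` and an edge to a right child is contracted in `T'`. -/
inductive IsFlip : PlaneTree → PlaneTree → PlaneTree → Prop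
  | root (A B C : PlaneTree) (hA : A.IsBinary) (hB : B.IsBinary) (hC : C.IsBinary) :
      IsFlip (node [node [A, B], C]) (node [A, node [B, C]]) (node [A, B, C])
  | left (T T' S R : PlaneTree) (h : IsFlip T T' S) (hR : R.IsBinary) :
      IsFlip (node [T, R]) (node [T', R]) (node [S, R])
  | right (L T T' S : PlaneTree) (hL : L.IsBinary) (h : IsFlip T T' S) :
      IsFlip (node [L, T]) (node [L, T']) (node [L, S])

section IsFlip

variable {T T' S U U' : PlaneTree}

theorem IsFlip.isBinary (h : IsFlip T T' S) : T.IsBinary ∧ T'.IsBinary := by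
  induction h with
  | root A B C hA hB hC => exact ⟨.node _ _ (.node A B hA hB) hC, .node _ _ hA (.node B C hB hC)⟩
  | left _ _ _ R _ hR ih => exact ⟨.node _ R ih.1 hR, .node _ R ih.2 hR⟩
  | right L _ _ _ hL _ ih => exact ⟨.node L _ hL ih.1, .node L _ hL ih.2⟩

theorem IsFlip.contractsEdge (h : IsFlip T T' S) : ContractsEdge 0 T S ∧ ContractsEdge 1 T' S := by
  induction h with
  | root A B C =>
    exact ⟨.root [] [A, B] [C] (by simp), .root [A] [B, C] [] (by simp)⟩
  | left _ _ _ R _ _ ih => exact ⟨.deeper 0 [] [R] _ _ ih.1, .deeper 1 [] [R] _ _ ih.2⟩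
  | right L _ _ _ _ _ ih => exact ⟨.deeper 0 [L] [] _ _ ih.1, .deeper 1 [L] [] _ _ ih.2⟩

theorem IsFlip.ne (h : IsFlip T T' S) : T ≠ T' := by
  induction h with
  | root A B C =>
    intro h
    have hA : node [A, B] = A := by simp_all
    have := congrArg sizeOf hA
    simp only [node.sizeOf_spec, List.cons.sizeOf_spec] at this
    omega
  | left _ _ _ _ _ _ ih => simpa using ih
  | right _ _ _ _ _ _ ih => simpa using ih

theorem IsFlip.not_isBinary (h : IsFlip T T' S) : ¬ S.IsBinary := by
  induction h with
  | root => intro h; cases h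
  | left _ _ _ _ _ _ ih => exact fun h => ih (isBinary_pair_iff.mp h).1
  | right _ _ _ _ _ _ ih => exact fun h => ih (isBinary_pair_iff.mp h).2

theorem IsFlip.unique (h : IsFlip T T' S) (h' : IsFlip U U' S) : T = U ∧ T' = U' := by
  induction h generalizing U U' with
  | root => cases h'; simp
  | left _ _ _ _ h _ ih =>
    cases h' with
    | left _ _ _ _ h' => simpa using ih h'
    | right _ _ _ _ hL => exact absurd hL h.not_isBinary
  | right _ _ _ _ _ h ih =>
    cases h' with
    | left _ _ _ _ _ hR => exact absurd hR h.not_isBinary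
    | right _ _ _ _ _ h' => simpa using ih h'

theorem append_cons_eq_pair_iff {l r : List PlaneTree} {t L R : PlaneTree} :
    l ++ t :: r = [L, R] ↔ l = [] ∧ t = L ∧ r = [R] ∨ l = [L] ∧ t = R ∧ r = [] := by
  match l with
  | [] => simp
  | [a] => simp
  | _ :: _ :: _ => simp

theorem ContractsEdge.exists_isFlip {j : ℕ} (h : ContractsEdge j U S) (hU : U.IsBinary) :
    ∃ T T', IsFlip T T' S ∧ (j = 0 ∧ U = T ∨ j = 1 ∧ U = T') := by
  induction h with
  | root l c r hc =>
    generalize hcs : l ++ node c :: r = cs at hU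
    rcases hU with _ | ⟨L, R, hL, hR⟩
    · simp at hcs
    rcases append_cons_eq_pair_iff.mp hcs with ⟨rfl, rfl, rfl⟩ | ⟨rfl, rfl, rfl⟩
    · rcases hL with _ | ⟨A, B, hA, hB⟩
      · simp at hc
      · exact ⟨_, _, .root A B R hA hB hR, by simp⟩
    · rcases hR with _ | ⟨B, C, hB, hC⟩
      · simp at hc
      · exact ⟨_, _, .root L B C hL hB hC, by simp⟩
  | deeper j l r t s _ ih =>
    generalize hcs : l ++ t :: r = cs at hU
    rcases hU with _ | ⟨L, R, hL, hR⟩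
    · simp at hcs
    rcases append_cons_eq_pair_iff.mp hcs with ⟨rfl, rfl, rfl⟩ | ⟨rfl, rfl, rfl⟩
    · obtain ⟨T, T', hflip, h⟩ := ih hL
      exact ⟨_, _, hflip.left _ _ _ R hR, by simpa using h⟩
    · obtain ⟨T, T', hflip, h⟩ := ih hR
      exact ⟨_, _, hflip.right L _ _ _ hL, by simpa using h⟩

theorem ContractsTo.exists_contractsEdge {j : ℕ} (h : U.ContractsTo S) (hU : U.IsBinary)
    (hT : T.IsBinary) (hTS : ContractsEdge j T S) : ∃ k, ContractsEdge k U S := by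
  have := hU.numInternal_add_one
  have := hT.numInternal_add_one
  have := h.numLeaves_eq
  have := hTS.numLeaves_eq
  have := hTS.numInternal_eq
  rcases Relation.ReflTransGen.cases_head h with rfl | ⟨V, ⟨k, hk⟩, hVS⟩
  · omega
  · have := hk.numInternal_eq
    rcases ContractsTo.eq_or_lt hVS with rfl | hlt
    · exact ⟨k, hk⟩
    · omega

end IsFlip

/-! ## Cartesian trees -/

theorem sum_Ico_cut {M : Type*} [AddCommMonoid M] (z : ℕ → M) {lo p hi : ℕ} (hlo : lo ≤ p)
    (hhi : p < hi) : ∑ i ∈ Finset.Ico lo hi, z i =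
      ∑ i ∈ Finset.Ico lo p, z i + z p + ∑ i ∈ Finset.Ico (p + 1) hi, z i := by
  rw [← Finset.sum_Ico_succ_top hlo, Finset.sum_Ico_consecutive _ (by omega) (by omega)]

theorem sum_sub_mul_Ico (m W : ℝ) (w z : ℕ → ℝ) (lo hi : ℕ) :
    ∑ i ∈ Finset.Ico lo hi, (W - w i) * z i =
      (W - m) * ∑ i ∈ Finset.Ico lo hi, z i + ∑ i ∈ Finset.Ico lo hi, (m - w i) * z i := by
  rw [Finset.mul_sum, ← Finset.sum_add_distrib]
  exact Finset.sum_congr rfl fun i _ => by ring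

section Basins

variable {R R' : Type*} [LinearOrder R] [LinearOrder R']

/-- `IsBasin w lo hi a b`: on `{a, …, b - 1} ⊆ {lo, …, hi - 1}` the weight `w` stays below its
values at the neighbours `a - 1` and `b` of this interval, as far as these lie in
`{lo, …, hi - 1}`. The basins are the brackets of the Cartesian tree of `w`. -/
structure IsBasin (w : ℕ → R) (lo hi a b : ℕ) : Prop where
  lo_le : lo ≤ a
  lt : a < b
  le_hi : b ≤ hi
  lt_boundary : ∀ i ∈ Finset.Ico a b, ∀ j ∈ Finset.Ico lo hi, j + 1 = a ∨ j = b → w i < w j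

theorem IsBasin.mono {w : ℕ → R} {w' : ℕ → R'} {lo hi a b : ℕ} (h : IsBasin w lo hi a b)
    (hw : ∀ i ∈ Finset.Ico lo hi, ∀ j ∈ Finset.Ico lo hi, w i < w j → w' i < w' j) :
    IsBasin w' lo hi a b where
  __ := h
  lt_boundary i hi j hj hab :=
    hw i (Finset.Ico_subset_Ico h.lo_le h.le_hi hi) j hj (h.lt_boundary i hi j hj hab)

theorem isBasin_cut {w : ℕ → R} {lo p hi a b : ℕ} (hlo : lo ≤ p) (hhi : p < hi) :
    (IsBasin w lo hi a b ∧ ∀ i ∈ Finset.Ico a b, w i < w p) ↔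
      (IsBasin w lo p a b ∧ ∀ i ∈ Finset.Ico a b, w i < w p) ∨
        (IsBasin w (p + 1) hi a b ∧ ∀ i ∈ Finset.Ico a b, w i < w p) := by
  rw [← or_and_right, and_congr_left_iff]
  intro hlt
  constructor
  · rintro ⟨hloa, hab, hbhi, hbd⟩
    have hcut : b ≤ p ∨ p < a := by
      by_contra! hcut
      exact (hlt p (Finset.mem_Ico.mpr ⟨hcut.2, hcut.1⟩)).false
    refine hcut.imp (fun hbp => ⟨hloa, hab, hbp, fun i hi j hj => ?_⟩)
      fun hpa => ⟨hpa, hab, hbhi, fun i hi j hj => ?_⟩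
    · exact hbd i hi j (Finset.Ico_subset_Ico le_rfl hhi.le hj)
    · exact hbd i hi j (Finset.Ico_subset_Ico (by omega) le_rfl hj)
  · rintro (⟨hloa, hab, hbp, hbd⟩ | ⟨hpa, hab, hbhi, hbd⟩)
    · refine ⟨hloa, hab, by omega, fun i hi j hj hj' => ?_⟩
      rcases eq_or_ne j p with rfl | hne
      · exact hlt i hi
      · exact hbd i hi j (Finset.mem_Ico.mpr (by rw [Finset.mem_Ico] at hj; omega)) hj'
    · refine ⟨by omega, hab, hbhi, fun i hi j hj hj' => ?_⟩
      rcases eq_or_ne j p with rfl | hne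
      · exact hlt i hi
      · exact hbd i hi j (Finset.mem_Ico.mpr (by rw [Finset.mem_Ico] at hj; omega)) hj'

theorem isBasin_raise {w : ℕ → R} {m W : R} {lo hi a b : ℕ} (hlt : lo < hi) (hm : m < W)
    (hw : ∀ i ∈ Finset.Ico lo hi, w i ≤ m) :
    (IsBasin w lo hi a b ∧ ∀ i ∈ Finset.Ico a b, w i < W) ↔
      (a = lo ∧ b = hi) ∨ (IsBasin w lo hi a b ∧ ∀ i ∈ Finset.Ico a b, w i < m) := by
  constructor
  · rintro ⟨h, -⟩
    have := h.lo_le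
    have := h.le_hi
    by_cases! hab : a = lo → b ≠ hi
    · obtain ⟨j, hj, hj'⟩ : ∃ j ∈ Finset.Ico lo hi, j + 1 = a ∨ j = b := by
        have := h.lt
        by_cases ha : a = lo
        · exact ⟨b, Finset.mem_Ico.mpr (by have := hab ha; omega), .inr rfl⟩
        · exact ⟨a - 1, Finset.mem_Ico.mpr (by omega), .inl (by omega)⟩
      exact .inr ⟨h, fun i hi => (h.lt_boundary i hi j hj hj').trans_le (hw j hj)⟩
    · exact .inl hab
  · rintro (⟨rfl, rfl⟩ | ⟨h, hlt⟩)
    · refine ⟨⟨le_rfl, hlt, le_rfl, fun i _ j hj hj' => ?_⟩, fun i hi => (hw i hi).trans_lt hm⟩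
      rw [Finset.mem_Ico] at hj
      omega
    · exact ⟨h, fun i hi => (hlt i hi).trans hm⟩

/-- `CartesianForest w W lo hi F`: the forest `F`, with leaves numbered `lo, …, hi`, is obtained
by cutting between the leaves `p` and `p + 1` for all `p` with `w p = W`, and treating the pieces
in the same way with their maximal weight in place of `W`. -/
inductive CartesianForest (w : ℕ → R) : R → ℕ → ℕ → List PlaneTree → Prop
  | leaf (W : R) (lo : ℕ) : CartesianForest w W lo lo [node []]
  | append (W : R) (lo p hi : ℕ) (F G : List PlaneTree) (hp : w p = W)
      (hF : CartesianForest w W lo p F) (hG : CartesianForest w W (p + 1) hi G) :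
      CartesianForest w W lo hi (F ++ G)
  | root (m W : R) (lo hi : ℕ) (F : List PlaneTree) (hm : m < W) (hlen : 2 ≤ F.length)
      (hF : CartesianForest w m lo hi F) : CartesianForest w W lo hi [node F]

namespace CartesianForest

variable {w : ℕ → R} {W : R} {lo hi : ℕ} {F : List PlaneTree} {T : PlaneTree}

theorem ne_nil (h : CartesianForest w W lo hi F) : F ≠ [] := by
  induction h with
  | leaf => simp
  | append _ _ _ _ _ _ _ _ _ ihF => simp [ihF]
  | root => simp

theorem add_leaves (h : CartesianForest w W lo hi F) : lo + leaves F = hi + 1 := by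
  induction h with
  | leaf => simp
  | append _ _ _ _ _ _ _ _ _ ihF ihG => rw [leaves_append]; omega
  | root _ _ _ _ _ _ _ hF ih =>
    rwa [leaves_cons, numLeaves_node hF.ne_nil, leaves_nil, add_zero]

theorem lo_le_hi (h : CartesianForest w W lo hi F) : lo ≤ hi := by
  induction h with
  | leaf => exact le_rfl
  | append _ _ _ _ _ _ _ _ _ ihF ihG => omega
  | root _ _ _ _ _ _ _ _ ih => exact ih

theorem strictlyBranching (h : CartesianForest w W lo hi F) : ∀ t ∈ F, t.StrictlyBranching := by
  induction h with
  | leaf => simp [strictlyBranching_node_iff]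
  | append _ _ _ _ _ _ _ _ _ ihF ihG => exact List.forall_mem_append.mpr ⟨ihF, ihG⟩
  | root _ _ _ _ _ _ hlen _ ih => simpa [strictlyBranching_node_iff] using ⟨Or.inr hlen, ih⟩

theorem weight_le (h : CartesianForest w W lo hi F) : ∀ i ∈ Finset.Ico lo hi, w i ≤ W := by
  induction h with
  | leaf => simp
  | append _ lo p hi _ _ hp _ _ ihF ihG =>
    intro i hi
    rw [Finset.mem_Ico] at hi
    rcases lt_trichotomy i p with hip | rfl | hip
    · exact ihF i (Finset.mem_Ico.mpr ⟨hi.1, hip⟩)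
    · exact hp.le
    · exact ihG i (Finset.mem_Ico.mpr ⟨hip, hi.2⟩)
  | root _ _ _ _ _ hm _ _ ih => exact fun i hi => (ih i hi).trans hm.le

theorem isBracket_iff (h : CartesianForest w W lo hi F) {a b : ℕ} :
    IsBracket F lo a b ↔ IsBasin w lo hi a b ∧ ∀ i ∈ Finset.Ico a b, w i < W := by
  induction h with
  | leaf =>
    rw [isBracket_singleton]
    refine ⟨by simp, fun ⟨h, _⟩ => ?_⟩
    have := h.lo_le; have := h.lt; have := h.le_hi
    omega
  | append _ lo p hi _ _ hp hF hG ihF ihG =>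
    subst hp
    rw [isBracket_append, hF.add_leaves, ihF, ihG,
      ← isBasin_cut hF.lo_le_hi (Nat.lt_of_succ_le hG.lo_le_hi)]
  | root m W lo hi F hm hlen hF ih =>
    have hlt : lo < hi := by
      have := hF.add_leaves
      have := length_le_leaves F
      omega
    rw [isBracket_singleton, hF.add_leaves, add_left_inj, ih, isBasin_raise hlt hm hF.weight_le]
    simp only [ne_eq, hF.ne_nil, not_false_eq_true, true_and]

theorem length_eq (h : CartesianForest w W lo hi F) :
    F.length = ∑ i ∈ Finset.Ico lo hi, (if w i = W then 1 else 0) + 1 := by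
  induction h with
  | leaf => simp
  | append _ lo p hi _ _ hp hF hG ihF ihG =>
    have := hG.lo_le_hi
    rw [sum_Ico_cut _ hF.lo_le_hi (by omega), List.length_append, ihF, ihG, if_pos hp]
    omega
  | root m W lo hi F hm hlen hF =>
    rw [Finset.sum_eq_zero]
    · simp
    · exact fun i hi => if_neg ((hF.weight_le i hi).trans_lt hm).ne

theorem weight_lt (h : CartesianForest w W lo hi [T]) : ∀ i ∈ Finset.Ico lo hi, w i < W := by
  intro i hi
  refine (h.weight_le i hi).lt_of_ne fun hiW => ?_
  have hcount := h.length_eq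
  rw [List.length_singleton, right_eq_add, Finset.sum_eq_zero_iff] at hcount
  simpa [hiW] using hcount i hi

theorem isBracket_singleton_iff (h : CartesianForest w W lo hi [T]) {a b : ℕ} :
    IsBracket [T] lo a b ↔ IsBasin w lo hi a b :=
  h.isBracket_iff.trans (and_iff_left_of_imp fun hab i hi =>
    h.weight_lt i (Finset.Ico_subset_Ico hab.lo_le hab.le_hi hi))

theorem isBinary (h : CartesianForest w W lo hi F) (hw : Set.InjOn w (Set.Ico lo hi)) :
    ∀ t ∈ F, t.IsBinary := by
  induction h with
  | leaf => simpa using IsBinary.leaf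
  | append _ lo p hi _ _ _ hF hG ihF ihG =>
    have := hF.lo_le_hi
    have := hG.lo_le_hi
    exact List.forall_mem_append.mpr ⟨ihF (hw.mono (Set.Ico_subset_Ico le_rfl (by omega))),
      ihG (hw.mono (Set.Ico_subset_Ico (by omega) le_rfl))⟩
  | root m _ lo hi F _ hlen hF ih =>
    have hcount : ∑ i ∈ Finset.Ico lo hi, (if w i = m then 1 else 0) ≤ 1 := by
      rw [← Finset.card_filter, Finset.card_le_one]
      simp only [Finset.mem_filter, Finset.mem_Ico]
      exact fun i hi j hj => hw hi.1 hj.1 (hi.2.trans hj.2.symm)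
    have := hF.length_eq
    obtain ⟨L, R, rfl⟩ := List.length_eq_two.mp (show F.length = 2 by omega)
    have hLR := ih hw
    simpa using IsBinary.node L R (hLR L (by simp)) (hLR R (by simp))

theorem congr {w' : ℕ → R} (h : CartesianForest w W lo hi F)
    (hw : ∀ i ∈ Finset.Ico lo hi, w i = w' i) : CartesianForest w' W lo hi F := by
  induction h with
  | leaf W lo => exact .leaf W lo
  | append W lo p hi F G hp hF hG ihF ihG =>
    have := hF.lo_le_hi
    have := hG.lo_le_hi
    exact .append W lo p hi F G (hw p (Finset.mem_Ico.mpr (by omega)) ▸ hp)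
      (ihF fun i hi => hw i (Finset.Ico_subset_Ico le_rfl (by omega) hi))
      (ihG fun i hi => hw i (Finset.Ico_subset_Ico (by omega) le_rfl hi))
  | root m W lo hi F hm hlen _ ih => exact .root m W lo hi F hm hlen (ih hw)

end CartesianForest

theorem exists_cartesianForest (w : ℕ → R) (W : R) {lo hi : ℕ} (hle : lo ≤ hi)
    (hw : ∀ i ∈ Finset.Ico lo hi, w i ≤ W) : ∃ F, CartesianForest w W lo hi F := by
  induction hn : hi - lo using Nat.strong_induction_on generalizing lo hi W with
  | _ n ih =>
    rcases hle.eq_or_lt with rfl | hlt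
    · exact ⟨_, .leaf W lo⟩
    obtain ⟨p, hp, hmax⟩ := Finset.exists_max_image (Finset.Ico lo hi) w ⟨lo, by simpa using hlt⟩
    have hmaxF : ∀ i ∈ Finset.Ico lo p, w i ≤ w p := fun i hi =>
      hmax i (Finset.Ico_subset_Ico le_rfl (Finset.mem_Ico.mp hp).2.le hi)
    have hmaxG : ∀ i ∈ Finset.Ico (p + 1) hi, w i ≤ w p := fun i hi =>
      hmax i (Finset.Ico_subset_Ico (by rw [Finset.mem_Ico] at hp; omega) le_rfl hi)
    rw [Finset.mem_Ico] at hp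
    obtain ⟨F, hF⟩ := ih (p - lo) (by omega) (w p) hp.1 hmaxF rfl
    obtain ⟨G, hG⟩ := ih (hi - (p + 1)) (by omega) (w p) hp.2 hmaxG rfl
    have hFG := hF.append _ _ _ _ _ _ rfl hG
    rcases (hw p (Finset.mem_Ico.mpr hp)).eq_or_lt with heq | hlt
    · exact ⟨F ++ G, heq ▸ hFG⟩
    · have := List.length_pos_iff.mpr hF.ne_nil
      have := List.length_pos_iff.mpr hG.ne_nil
      exact ⟨_, .root (w p) W lo hi (F ++ G) hlt (by rw [List.length_append]; omega) hFG⟩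

theorem exists_cartesianTree (w : ℕ → R) (W : R) {lo hi : ℕ} (hle : lo ≤ hi)
    (hw : ∀ i ∈ Finset.Ico lo hi, w i < W) : ∃ T, CartesianForest w W lo hi [T] := by
  obtain ⟨F, hF⟩ := exists_cartesianForest w W hle fun i hi => (hw i hi).le
  have hlen := hF.length_eq
  rw [Finset.sum_eq_zero fun i hi => if_neg (hw i hi).ne, zero_add, List.length_eq_one_iff] at hlen
  obtain ⟨T, rfl⟩ := hlen
  exact ⟨T, hF⟩

end Basins

theorem exists_cartesianForest_of_forest (F : List PlaneTree) (hF : ∀ t ∈ F, t.StrictlyBranching)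
    (hne : F ≠ []) {lo hi : ℕ} (W : ℝ) (hl : lo + leaves F = hi + 1) :
    ∃ w : ℕ → ℝ, CartesianForest w W lo hi F := by
  induction F using forest_induction generalizing lo hi W with
  | nil => exact absurd rfl hne
  | cons cs ds ihcs ihds =>
    obtain ⟨hT, hds⟩ := List.forall_mem_cons.mp hF
    obtain ⟨hlen, hcs⟩ := strictlyBranching_node_iff.mp hT
    have hhead : ∀ hi, lo + (node cs).numLeaves = hi + 1 →
        ∃ w : ℕ → ℝ, CartesianForest w W lo hi [node cs] := by
      intro hi hl
      rcases eq_or_ne cs [] with rfl | hcs_ne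
      · obtain rfl : lo = hi := by simpa using hl
        exact ⟨0, .leaf W lo⟩
      · obtain ⟨w, hw⟩ := ihcs hcs hcs_ne (W - 1) (numLeaves_node hcs_ne ▸ hl)
        exact ⟨w, hw.root _ _ _ _ _ (sub_one_lt W) (hlen.resolve_left hcs_ne)⟩
    rw [leaves_cons] at hl
    rcases eq_or_ne ds [] with rfl | hds_ne
    · exact hhead hi (by simpa using hl)
    · have := numLeaves_pos (node cs)
      obtain ⟨p, hp⟩ : ∃ p, lo + (node cs).numLeaves = p + 1 :=
        ⟨lo + (node cs).numLeaves - 1, by omega⟩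
      obtain ⟨w₁, h₁⟩ := hhead p hp
      obtain ⟨w₂, h₂⟩ := ihds hds hds_ne (lo := p + 1) (hi := hi) W (by omega)
      let w : ℕ → ℝ := fun i => if i < p then w₁ i else if i = p then W else w₂ i
      refine ⟨w, .append W lo p hi [node cs] ds (by simp [w]) (h₁.congr fun i hi => ?_)
        (h₂.congr fun i hi => ?_)⟩
      · simp [w, (Finset.mem_Ico.mp hi).2]
      · have := Finset.mem_Ico.mp hi
        simp [w, show ¬ i < p by omega, show i ≠ p by omega]

theorem exists_cartesianForest_of_tree {T : PlaneTree} (hT : T.StrictlyBranching) {n : ℕ}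
    (hl : T.numLeaves = n + 1) (W : ℝ) : ∃ w : ℕ → ℝ, CartesianForest w W 0 n [T] :=
  exists_cartesianForest_of_forest [T] (by simpa using hT) (by simp) W (by simpa using hl)

section BracketSums

variable {w z : ℕ → ℝ} {W : ℝ} {lo hi : ℕ} {F : List PlaneTree}

theorem CartesianForest.sum_nonneg (h : CartesianForest w W lo hi F)
    (hz : ∀ a b, IsBracket F lo a b → 0 ≤ ∑ i ∈ Finset.Ico a b, z i) :
    0 ≤ ∑ i ∈ Finset.Ico lo hi, (W - w i) * z i := by
  induction h with
  | leaf => simp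
  | append W lo p hi F G hp hF hG ihF ihG =>
    simp only [isBracket_append, hF.add_leaves] at hz
    rw [sum_Ico_cut _ hF.lo_le_hi hG.lo_le_hi, hp, sub_self, zero_mul, add_zero]
    exact add_nonneg (ihF fun a b hab => hz a b (.inl hab)) (ihG fun a b hab => hz a b (.inr hab))
  | root m W lo hi F hm _ hF ih =>
    simp only [isBracket_singleton, hF.add_leaves, add_left_inj] at hz
    have hroot := hz lo hi (.inl ⟨hF.ne_nil, rfl, rfl⟩)
    rw [sum_sub_mul_Ico m]
    exact add_nonneg (mul_nonneg (sub_nonneg.mpr hm.le) hroot) (ih fun a b hab => hz a b (.inr hab))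

theorem CartesianForest.sum_eq_zero (h : CartesianForest w W lo hi F)
    (hz : ∀ a b, IsBracket F lo a b → 0 ≤ ∑ i ∈ Finset.Ico a b, z i)
    (hsum : ∑ i ∈ Finset.Ico lo hi, (W - w i) * z i = 0) {a b : ℕ} (hab : IsBracket F lo a b) :
    ∑ i ∈ Finset.Ico a b, z i = 0 := by
  induction h with
  | leaf => simp [isBracket_singleton] at hab
  | append W lo p hi F G hp hF hG ihF ihG =>
    simp only [isBracket_append, hF.add_leaves] at hz hab
    have hzF := fun a b hab => hz a b (.inl hab)
    have hzG := fun a b hab => hz a b (.inr hab)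
    rw [sum_Ico_cut _ hF.lo_le_hi hG.lo_le_hi, hp, sub_self, zero_mul, add_zero,
      add_eq_zero_iff_of_nonneg (hF.sum_nonneg hzF) (hG.sum_nonneg hzG)] at hsum
    exact hab.elim (ihF hzF hsum.1) (ihG hzG hsum.2)
  | root m W lo hi F hm _ hF ih =>
    simp only [isBracket_singleton, hF.add_leaves, add_left_inj] at hz hab
    have hroot := hz lo hi (.inl ⟨hF.ne_nil, rfl, rfl⟩)
    have hzF := fun a b hab => hz a b (.inr hab)
    rw [sum_sub_mul_Ico m, add_eq_zero_iff_of_nonneg (mul_nonneg (sub_nonneg.mpr hm.le) hroot)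
      (hF.sum_nonneg hzF), mul_eq_zero_iff_left (sub_ne_zero.mpr hm.ne')] at hsum
    rcases hab with ⟨-, rfl, rfl⟩ | hab
    · exact hsum.1
    · exact ih hzF hsum.2 hab

end BracketSums

/-! ## Binary refinements of a tree -/

theorem exists_isBinary_isBasin {w : ℕ → ℝ} {W : ℝ} {n : ℕ} (hw : ∀ i ∈ Finset.Ico 0 n, w i < W)
    {t : ℕ → ℤ} (ht : t.Injective) :
    ∃ U : PlaneTree, U.IsBinary ∧ U.numLeaves = n + 1 ∧
      ∀ a b, IsBracket [U] 0 a b ↔ IsBasin (fun i => toLex (w i, t i)) 0 n a b := by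
  have hinj : Function.Injective fun i => toLex (w i, t i) := fun i j hij =>
    ht (congrArg Prod.snd (toLex_inj.mp hij))
  obtain ⟨U, hU⟩ := exists_cartesianTree (fun i => toLex (w i, t i)) (toLex (W, 0)) n.zero_le
    fun i hi => Prod.Lex.toLex_lt_toLex.mpr (.inl (hw i hi))
  exact ⟨U, hU.isBinary hinj.injOn U (by simp), by simpa using hU.add_leaves,
    fun a b => hU.isBracket_singleton_iff⟩

theorem IsBasin.lex {w : ℕ → ℝ} {n a b : ℕ} (h : IsBasin w 0 n a b) (t : ℕ → ℤ) :
    IsBasin (fun i => toLex (w i, t i)) 0 n a b :=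
  h.mono fun _ _ _ _ hij => Prod.Lex.toLex_lt_toLex.mpr (.inl hij)

theorem StrictlyBranching.exists_isBinary_refines {T : PlaneTree} (hT : T.StrictlyBranching) :
    ∃ U : PlaneTree, U.IsBinary ∧ U.numLeaves = T.numLeaves ∧ Refines 0 [U] [T] := by
  obtain ⟨n, hn⟩ := Nat.exists_eq_add_one.mpr T.numLeaves_pos
  obtain ⟨w, hw⟩ := exists_cartesianForest_of_tree hT hn 0
  obtain ⟨U, hU, hUn, hUb⟩ := exists_isBinary_isBasin hw.weight_lt Nat.cast_injective
  exact ⟨U, hU, hUn.trans hn.symm, fun a b hab =>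
    (hUb a b).mpr ((hw.isBracket_singleton_iff.mp hab).lex _)⟩

theorem StrictlyBranching.exists_isBinary_avoiding {T : PlaneTree} (hT : T.StrictlyBranching)
    {a b : ℕ} (hab : a < b) (hb : b < T.numLeaves) (hTab : ¬ IsBracket [T] 0 a b) :
    ∃ U : PlaneTree, U.IsBinary ∧ U.numLeaves = T.numLeaves ∧ Refines 0 [U] [T] ∧
      ¬ IsBracket [U] 0 a b := by
  obtain ⟨n, hn⟩ := Nat.exists_eq_add_one.mpr T.numLeaves_pos
  obtain ⟨w, hw⟩ := exists_cartesianForest_of_tree hT hn 0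
  obtain ⟨i, hi, j, hj, hbd, hle⟩ : ∃ i ∈ Finset.Ico a b, ∃ j ∈ Finset.Ico 0 n,
      (j + 1 = a ∨ j = b) ∧ w j ≤ w i := by
    by_contra! hc
    exact hTab (hw.isBracket_singleton_iff.mpr ⟨a.zero_le, hab, by omega, hc⟩)
  -- Breaking ties in favour of `i` destroys the basin `(a, b)`.
  obtain ⟨t, ht, htlt⟩ : ∃ t : ℕ → ℤ, t.Injective ∧ t j < t i := by
    rw [Finset.mem_Ico] at hi
    rcases hbd with rfl | rfl
    · exact ⟨Nat.cast, Nat.cast_injective, by omega⟩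
    · exact ⟨fun k => -k, neg_injective.comp Nat.cast_injective, by dsimp only; omega⟩
  obtain ⟨U, hU, hUn, hUb⟩ := exists_isBinary_isBasin hw.weight_lt ht
  refine ⟨U, hU, hUn.trans hn.symm, fun a b hab =>
    (hUb a b).mpr ((hw.isBracket_singleton_iff.mp hab).lex t), fun hUab => ?_⟩
  rcases Prod.Lex.toLex_lt_toLex.mp (((hUb a b).mp hUab).lt_boundary i hi j hj hbd) with h | h
  · exact hle.not_gt h
  · exact htlt.not_gt h.2

end PlaneTree

/-! ## Interval sums of the vertices -/

theorem initialSum_zero {n : ℕ} (α : Fin n → ℝ) : initialSum α 0 = 0 := by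
  simp [initialSum]

theorem initialSum_succ {n : ℕ} (α : Fin n → ℝ) {t : ℕ} (ht : t < n) :
    initialSum α (t + 1) = initialSum α t + α ⟨t, ht⟩ := by
  have hfilter : (Finset.univ.filter fun k : Fin n => k.val < t + 1) =
      insert ⟨t, ht⟩ (Finset.univ.filter fun k : Fin n => k.val < t) := by
    ext k
    simp only [Finset.mem_filter_univ, Finset.mem_insert, Fin.ext_iff]
    omega
  rw [initialSum, hfilter, Finset.sum_insert (by simp), add_comm, initialSum]

/-- The value `val(α, S)` of a complete binary tree `S` whose left and right subtrees have `x` and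
`y` internal vertices. -/
noncomputable def splitVal {n : ℕ} (α : Fin n → ℝ) (x y : ℕ) : ℝ :=
  initialSum α (x + y + 1) - initialSum α x - initialSum α y

theorem splitVal_comm {n : ℕ} (α : Fin n → ℝ) (x y : ℕ) : splitVal α x y = splitVal α y x := by
  rw [splitVal, splitVal, add_comm x y, sub_right_comm]

section SplitVal

variable {n : ℕ} {α : Fin n → ℝ} {x x' y y' : ℕ}

theorem splitVal_lt_succ_left (hα : StrictMono α) (h : x + y + 1 < n) :
    splitVal α x y < splitVal α (x + 1) y := by
  have hx : x < n := by omega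
  have hlt : α ⟨x, hx⟩ < α ⟨x + y + 1, h⟩ := hα (Fin.mk_lt_mk.mpr (by omega))
  rw [splitVal, splitVal, add_right_comm x 1 y, initialSum_succ α h, initialSum_succ α hx]
  linarith

theorem splitVal_lt_left (hα : StrictMono α) (hx : x < x') (h : x' + y < n) :
    splitVal α x y < splitVal α x' y := by
  induction x', hx using Nat.le_induction with
  | base => exact splitVal_lt_succ_left hα (by omega)
  | succ m _ ih => exact (ih (by omega)).trans (splitVal_lt_succ_left hα (by omega))

theorem splitVal_le_left (hα : StrictMono α) (hx : x ≤ x') (h : x' + y < n) :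
    splitVal α x y ≤ splitVal α x' y := by
  rcases hx.eq_or_lt with rfl | hx
  · exact le_rfl
  · exact (splitVal_lt_left hα hx h).le

theorem splitVal_le (hα : StrictMono α) (hx : x ≤ x') (hy : y ≤ y') (h : x' + y' < n) :
    splitVal α x y ≤ splitVal α x' y' := calc
  splitVal α x y ≤ splitVal α x' y := splitVal_le_left hα hx (by omega)
  _ = splitVal α y x' := splitVal_comm α x' y
  _ ≤ splitVal α y' x' := splitVal_le_left hα hy (by omega)
  _ = splitVal α x' y' := splitVal_comm α y' x'

theorem splitVal_lt (hα : StrictMono α) (hx : x ≤ x') (hy : y ≤ y') (hne : x + y < x' + y')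
    (h : x' + y' < n) : splitVal α x y < splitVal α x' y' := by
  rcases hx.eq_or_lt with rfl | hlt
  · rw [splitVal_comm, splitVal_comm α x]
    exact splitVal_lt_left hα (by omega) (by omega)
  · exact (splitVal_lt_left hα hlt (by omega)).trans_le (splitVal_le hα le_rfl hy h)

end SplitVal

namespace PlaneTree

/-- The sum of the coordinates `a, …, b - 1` of the point `v_T^α`. -/
noncomputable def valSum {n : ℕ} (α : Fin n → ℝ) (T : PlaneTree) (a b : ℕ) : ℝ :=
  ∑ i ∈ Finset.Ico a b, treeVal α (T.subtreeAt i)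

theorem subtreeAt_pair (L R : PlaneTree) {i : ℕ} (hi : i + 1 < L.numLeaves + R.numLeaves) :
    (node [L, R]).subtreeAt i =
      if i + 1 < L.numLeaves then L.subtreeAt i
      else if i + 1 = L.numLeaves then node [L, R]
      else R.subtreeAt (i - L.numLeaves) := by
  have := L.numLeaves_pos
  rw [subtreeAt, subtreeAt.go, subtreeAt.go]
  split_ifs <;> first | omega | rfl

theorem numInternal_pair (L R : PlaneTree) :
    (node [L, R]).numInternal = L.numInternal + R.numInternal + 1 := by
  simp [numInternal_node, add_comm]

theorem treeVal_pair {n : ℕ} (α : Fin n → ℝ) (L R : PlaneTree) :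
    treeVal α (node [L, R]) = splitVal α L.numInternal R.numInternal := by
  rw [treeVal, numInternal_pair, splitVal]

section ValSum

variable {n : ℕ} (α : Fin n → ℝ) {L R T : PlaneTree} {a b : ℕ}

theorem valSum_pair_left (R : PlaneTree) (hb : b < L.numLeaves) :
    valSum α (node [L, R]) a b = valSum α L a b := by
  refine Finset.sum_congr rfl fun i hi => ?_
  rw [Finset.mem_Ico] at hi
  rw [subtreeAt_pair L R (by omega), if_pos (by omega)]

theorem valSum_pair_right (L : PlaneTree) (hb : b < R.numLeaves) :
    valSum α (node [L, R]) (a + L.numLeaves) (b + L.numLeaves) = valSum α R a b := by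
  rw [valSum, ← Finset.sum_Ico_add']
  refine Finset.sum_congr rfl fun i hi => ?_
  rw [Finset.mem_Ico] at hi
  rw [subtreeAt_pair L R (by omega), if_neg (by omega), if_neg (by omega), Nat.add_sub_cancel]

theorem valSum_pair_cut (ha : a < L.numLeaves) (hb : b < R.numLeaves) :
    valSum α (node [L, R]) a (b + L.numLeaves) =
      valSum α L a (L.numLeaves - 1) + splitVal α L.numInternal R.numInternal + valSum α R 0 b := by
  have hright := valSum_pair_right α L hb (a := 0)
  rw [Nat.zero_add] at hright
  rw [← valSum_pair_left α R (Nat.sub_one_lt_of_lt ha), ← hright, valSum,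
    sum_Ico_cut _ (Nat.le_sub_one_of_lt ha) (by omega), subtreeAt_pair L R (by omega),
    if_neg (by omega), if_pos (by omega), treeVal_pair, Nat.sub_add_cancel (by omega), valSum,
    valSum]

theorem IsBinary.valSum_eq (hT : T.IsBinary) :
    valSum α T 0 (T.numLeaves - 1) = initialSum α (T.numLeaves - 1) := by
  induction hT with
  | leaf => simp [valSum, initialSum_zero]
  | node L R hL hR ihL ihR =>
    have hxL := hL.numInternal_add_one
    have hxR := hR.numInternal_add_one
    rw [numLeaves_pair, show L.numLeaves + R.numLeaves - 1 = R.numLeaves - 1 + L.numLeaves by omega,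
      valSum_pair_cut α (by omega) (by omega), ihL, ihR, splitVal, ← hxL, ← hxR]
    simp only [Nat.add_sub_cancel]
    rw [← Nat.add_assoc, Nat.add_comm R.numInternal]
    ring

variable {α}

theorem initialSum_eq_add_splitVal {k : ℕ} (ha : a < k) : initialSum α (b + k - a) =
    initialSum α (k - 1 - a) + splitVal α (k - 1 - a) b + initialSum α b := by
  rw [splitVal, show k - 1 - a + b + 1 = b + k - a by omega]
  ring

theorem IsBinary.initialSum_le_valSum (hα : StrictMono α) (hT : T.IsBinary)
    (hn : T.numLeaves ≤ n + 1) (hab : a ≤ b) (hb : b < T.numLeaves) :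
    initialSum α (b - a) ≤ valSum α T a b := by
  induction hT generalizing a b with
  | leaf =>
    obtain rfl : a = b := by rw [numLeaves_leaf] at hb; omega
    simp [valSum, initialSum_zero]
  | node L R hL hR ihL ihR =>
    have hxL := hL.numInternal_add_one
    have hxR := hR.numInternal_add_one
    rw [numLeaves_pair] at hn hb
    rcases lt_or_ge b L.numLeaves with hbL | hbL
    · rw [valSum_pair_left α R hbL]
      exact ihL (by omega) hab hbL
    obtain ⟨b, rfl⟩ := Nat.exists_eq_add_of_le' hbL
    rcases lt_or_ge a L.numLeaves with haL | haL
    · rw [valSum_pair_cut α haL (by omega), initialSum_eq_add_splitVal haL]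
      gcongr
      · exact ihL (by omega) (by omega) (by omega)
      · exact splitVal_le hα (by omega) (by omega) (by omega)
      · exact ihR (by omega) (a := 0) (by omega) (by omega)
    · obtain ⟨a, rfl⟩ := Nat.exists_eq_add_of_le' haL
      rw [valSum_pair_right α L (by omega), Nat.add_sub_add_right]
      exact ihR (by omega) (by omega) (by omega)

theorem isBracket_pair (L R : PlaneTree) (a b : ℕ) : IsBracket [node [L, R]] 0 a b ↔
    (a = 0 ∧ b + 1 = L.numLeaves + R.numLeaves) ∨ IsBracket [L] 0 a b ∨
      IsBracket [R] L.numLeaves a b := by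
  rw [isBracket_singleton, isBracket_cons]
  simp

theorem IsBinary.initialSum_lt_valSum (hα : StrictMono α) (hT : T.IsBinary)
    (hn : T.numLeaves ≤ n + 1) (hab : a < b) (hb : b < T.numLeaves)
    (hTab : ¬ IsBracket [T] 0 a b) : initialSum α (b - a) < valSum α T a b := by
  induction hT generalizing a b with
  | leaf => rw [numLeaves_leaf] at hb; omega
  | node L R hL hR ihL ihR =>
    have hxL := hL.numInternal_add_one
    have hxR := hR.numInternal_add_one
    rw [numLeaves_pair] at hn hb
    simp only [isBracket_pair, not_or] at hTab
    obtain ⟨hroot, hTL, hTR⟩ := hTab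
    rcases lt_or_ge b L.numLeaves with hbL | hbL
    · rw [valSum_pair_left α R hbL]
      exact ihL (by omega) hab hbL hTL
    obtain ⟨b, rfl⟩ := Nat.exists_eq_add_of_le' hbL
    rcases lt_or_ge a L.numLeaves with haL | haL
    · rw [valSum_pair_cut α haL (by omega), initialSum_eq_add_splitVal haL]
      refine add_lt_add_of_lt_of_le (add_lt_add_of_le_of_lt ?_ ?_) ?_
      · exact hL.initialSum_le_valSum hα (by omega) (by omega) (by omega)
      · exact splitVal_lt hα (by omega) (by omega) (by omega) (by omega)
      · exact hR.initialSum_le_valSum hα (by omega) (a := 0) (by omega) (by omega)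
    · obtain ⟨a, rfl⟩ := Nat.exists_eq_add_of_le' haL
      have hshift := isBracket_add_right [R] 0 a b L.numLeaves
      rw [Nat.zero_add] at hshift
      rw [valSum_pair_right α L (by omega), Nat.add_sub_add_right]
      exact ihR (by omega) (by omega) (by omega) (hshift.not.mp hTR)

variable (α) in
theorem IsBinary.valSum_eq_of_isBracket (hT : T.IsBinary) (hTab : IsBracket [T] 0 a b) :
    valSum α T a b = initialSum α (b - a) := by
  induction hT generalizing a b with
  | leaf => simp [isBracket_singleton] at hTab
  | node L R hL hR ihL ihR =>
    rcases (isBracket_pair L R a b).mp hTab with ⟨rfl, hb⟩ | hTL | hTR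
    · obtain rfl : b = (PlaneTree.node [L, R]).numLeaves - 1 := by rw [numLeaves_pair]; omega
      exact (hL.node L R hR).valSum_eq α
    · rw [valSum_pair_left α R (by simpa using (hTL.bounds_singleton hL.strictlyBranching).2.2)]
      exact ihL hTL
    · have hbounds := hTR.bounds_singleton hR.strictlyBranching
      obtain ⟨a, rfl⟩ := Nat.exists_eq_add_of_le' hbounds.1
      obtain ⟨b, rfl⟩ := Nat.exists_eq_add_of_le' (hbounds.1.trans hbounds.2.1.le)
      have hshift := isBracket_add_right [R] 0 a b L.numLeaves
      rw [Nat.zero_add] at hshift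
      rw [valSum_pair_right α L (by omega), Nat.add_sub_add_right]
      exact ihR (hshift.mp hTR)

end ValSum

end PlaneTree

open PlaneTree

/-! ## Faces of the Loday associahedron -/

section CoordinateSums

variable {n : ℕ}

/-- The vector `x`, continued by `0` to a sequence. -/
noncomputable def extendZero : (Fin n → ℝ) →ₗ[ℝ] ℕ → ℝ :=
  Function.ExtendByZero.linearMap ℝ Fin.val

@[simp] theorem extendZero_val (x : Fin n → ℝ) (i : Fin n) : extendZero x i = x i :=
  Fin.val_injective.extend_apply x 0 i

/-- The sum of the coordinates `a, …, b - 1` of a vector. -/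
noncomputable def intervalSum (a b : ℕ) : (Fin n → ℝ) →ₗ[ℝ] ℝ :=
  ∑ i ∈ Finset.Ico a b, LinearMap.proj i ∘ₗ extendZero

theorem intervalSum_apply (a b : ℕ) (x : Fin n → ℝ) :
    intervalSum a b x = ∑ i ∈ Finset.Ico a b, extendZero x i := by
  simp [intervalSum]

theorem sum_Ico_extendZero (f : ℝ → ℝ → ℝ) (w x : Fin n → ℝ) :
    ∑ i ∈ Finset.Ico 0 n, f (extendZero w i) (extendZero x i) = ∑ i, f (w i) (x i) := by
  rw [← Finset.range_eq_Ico,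
    ← Fin.sum_univ_eq_sum_range fun i => f (extendZero w i) (extendZero x i)]
  simp only [extendZero_val]

theorem intervalSum_zero_self (x : Fin n → ℝ) : intervalSum 0 n x = ∑ i, x i := by
  rw [intervalSum_apply]
  exact sum_Ico_extendZero (fun _ t => t) 0 x

end CoordinateSums

namespace SBTree

variable {n : ℕ} {T S : SBTree n}

theorem le_iff : T ≤ S ↔ ∀ a b, IsBracket [S.1] 0 a b → IsBracket [T.1] 0 a b :=
  contractsTo_iff T.2.1 S.2.1 (T.2.2.trans S.2.2.symm)

theorem bounds_of_isBracket {a b : ℕ} (h : IsBracket [T.1] 0 a b) : a < b ∧ b ≤ n := by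
  have hbounds := h.bounds_singleton T.2.1
  rw [T.2.2] at hbounds
  omega

/-- `T` is the tree that arises by cutting the leaves at the largest entries of `w` and treating
the pieces in the same way. -/
def IsCartesianTree (T : SBTree n) (w : Fin n → ℝ) : Prop :=
  ∃ W, CartesianForest (extendZero w) W 0 n [T.1]

theorem exists_isCartesianTree_of_vector (w : Fin n → ℝ) : ∃ T : SBTree n, T.IsCartesianTree w := by
  obtain ⟨W, hW⟩ := Finset.exists_le (Finset.univ.image fun i => w i + 1)
  obtain ⟨T, hT⟩ := exists_cartesianTree (extendZero w) W n.zero_le fun i hi => by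
    lift i to Fin n using (Finset.mem_Ico.mp hi).2
    rw [extendZero_val]
    exact (lt_add_one _).trans_le (hW _ (Finset.mem_image_of_mem _ (Finset.mem_univ i)))
  exact ⟨⟨T, hT.strictlyBranching T (by simp), by simpa using hT.add_leaves⟩, W, hT⟩

theorem exists_isCartesianTree (T : SBTree n) : ∃ w, T.IsCartesianTree w := by
  obtain ⟨w, hw⟩ := exists_cartesianForest_of_tree T.2.1 T.2.2 0
  refine ⟨fun i => w i, 0, hw.congr fun i hi => ?_⟩
  lift i to Fin n using (Finset.mem_Ico.mp hi).2
  exact (extendZero_val (fun i : Fin n => w i) i).symm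

namespace IsCartesianTree

variable {w z : Fin n → ℝ}

theorem isBracket_iff (h : T.IsCartesianTree w) {a b : ℕ} :
    IsBracket [T.1] 0 a b ↔ IsBasin (extendZero w) 0 n a b :=
  h.elim fun _ hW => hW.isBracket_singleton_iff

theorem sum_sub_mul (W : ℝ) (hz : ∑ i, z i = 0) :
    ∑ i ∈ Finset.Ico 0 n, (W - extendZero w i) * extendZero z i = -(w ⬝ᵥ z) := by
  rw [sum_Ico_extendZero fun s t => (W - s) * t]
  simp only [sub_mul, Finset.sum_sub_distrib, ← Finset.mul_sum, hz, mul_zero, zero_sub, dotProduct]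

theorem dotProduct_nonpos (h : T.IsCartesianTree w) (hz : ∑ i, z i = 0)
    (hbr : ∀ a b, IsBracket [T.1] 0 a b → 0 ≤ intervalSum a b z) : w ⬝ᵥ z ≤ 0 := by
  obtain ⟨W, hW⟩ := h
  simp only [intervalSum_apply] at hbr
  have hsum := hW.sum_nonneg hbr
  rwa [sum_sub_mul W hz, neg_nonneg] at hsum

theorem intervalSum_eq_zero (h : T.IsCartesianTree w) (hz : ∑ i, z i = 0)
    (hbr : ∀ a b, IsBracket [T.1] 0 a b → 0 ≤ intervalSum a b z) (hwz : w ⬝ᵥ z = 0) {a b : ℕ}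
    (hab : IsBracket [T.1] 0 a b) : intervalSum a b z = 0 := by
  obtain ⟨W, hW⟩ := h
  simp only [intervalSum_apply] at hbr ⊢
  exact hW.sum_eq_zero hbr (by rw [sum_sub_mul W hz, hwz, neg_zero]) hab

end IsCartesianTree

end SBTree

namespace CBTree

variable {n : ℕ}

theorem isBinary (T : CBTree n) : T.1.1.IsBinary :=
  isBinary_iff.mpr ⟨T.1.2.1, by rw [T.2, T.1.2.2]⟩

theorem exists_eq {T : PlaneTree} (hT : T.IsBinary) (hl : T.numLeaves = n + 1) :
    ∃ S : CBTree n, S.1.1 = T :=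
  ⟨⟨⟨T, hT.strictlyBranching, hl⟩, by have := hT.numInternal_add_one; simp only; omega⟩, rfl⟩

end CBTree

theorem SBTree.exists_binary_le {n : ℕ} (T : SBTree n) : ∃ U : CBTree n, U.1 ≤ T := by
  obtain ⟨U, hU, hl, hUT⟩ := T.2.1.exists_isBinary_refines
  obtain ⟨U, rfl⟩ := CBTree.exists_eq hU (hl.trans T.2.2)
  exact ⟨U, le_iff.mpr hUT⟩

theorem SBTree.exists_binary_le_avoiding {n : ℕ} (T : SBTree n) {a b : ℕ} (hab : a < b)
    (hb : b ≤ n) (hTab : ¬ IsBracket [T.1] 0 a b) :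
    ∃ U : CBTree n, U.1 ≤ T ∧ ¬ IsBracket [U.1.1] 0 a b := by
  obtain ⟨U, hU, hl, hUT, hUab⟩ :=
    T.2.1.exists_isBinary_avoiding hab (by rw [T.2.2]; omega) hTab
  obtain ⟨U, rfl⟩ := CBTree.exists_eq hU (hl.trans T.2.2)
  exact ⟨U, le_iff.mpr hUT, hUab⟩

section Faces

variable {n : ℕ} {α : Fin n → ℝ}

theorem intervalSum_lodayVertex (α : Fin n → ℝ) (T : CBTree n) {a b : ℕ} (hb : b ≤ n) :
    intervalSum a b (lodayVertex α T) = valSum α T.1.1 a b := by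
  rw [intervalSum_apply]
  refine Finset.sum_congr rfl fun i hi => ?_
  lift i to Fin n using (Finset.mem_Ico.mp hi).2.trans_le hb
  exact extendZero_val _ i

theorem intervalSum_lodayVertex_eq_iff (hα : StrictMono α) (T : CBTree n) {a b : ℕ} (hab : a < b)
    (hb : b ≤ n) :
    intervalSum a b (lodayVertex α T) = initialSum α (b - a) ↔ IsBracket [T.1.1] 0 a b := by
  rw [intervalSum_lodayVertex α T hb]
  have hl := T.1.2.2
  refine ⟨fun h => ?_, T.isBinary.valSum_eq_of_isBracket α⟩
  contrapose! h
  exact (T.isBinary.initialSum_lt_valSum hα hl.le hab (by omega) h).ne'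

theorem lodayVertex_mem_lodAsso (α : Fin n → ℝ) (T : CBTree n) : lodayVertex α T ∈ LodAsso α :=
  subset_convexHull ℝ _ ⟨T, rfl⟩

theorem initialSum_le_intervalSum (hα : StrictMono α) {x : Fin n → ℝ} (hx : x ∈ LodAsso α)
    {a b : ℕ} (hab : a ≤ b) (hb : b ≤ n) : initialSum α (b - a) ≤ intervalSum a b x := by
  refine convexHull_min ?_ (convex_halfSpace_ge (intervalSum a b).isLinear _) hx
  rintro _ ⟨T, rfl⟩
  have hl := T.1.2.2
  rw [Set.mem_ofPred_eq, intervalSum_lodayVertex α T hb]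
  exact T.isBinary.initialSum_le_valSum hα hl.le hab (by omega)

theorem sum_of_mem_lodAsso {x : Fin n → ℝ} (hx : x ∈ LodAsso α) :
    ∑ i, x i = initialSum α n := by
  rw [← intervalSum_zero_self]
  refine convexHull_min ?_ (convex_hyperplane (intervalSum 0 n).isLinear _) hx
  rintro _ ⟨T, rfl⟩
  rw [Set.mem_ofPred_eq, intervalSum_lodayVertex α T le_rfl]
  simpa [T.1.2.2] using T.isBinary.valSum_eq α

/-- The face of the Loday associahedron that belongs to the tree `T`: the points at which the
coordinate sums over all brackets of `T` are minimal. -/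
def treeFace (α : Fin n → ℝ) (T : SBTree n) : Set (Fin n → ℝ) :=
  {x ∈ LodAsso α | ∀ a b, IsBracket [T.1] 0 a b → intervalSum a b x = initialSum α (b - a)}

theorem lodayVertex_mem_treeFace (hα : StrictMono α) {U : CBTree n} {T : SBTree n} :
    lodayVertex α U ∈ treeFace α T ↔ U.1 ≤ T := by
  simp only [treeFace, Set.mem_ofPred_eq, lodayVertex_mem_lodAsso, true_and, SBTree.le_iff]
  refine forall₃_congr fun a b hab => ?_
  have hbounds := SBTree.bounds_of_isBracket hab
  exact intervalSum_lodayVertex_eq_iff hα U hbounds.1 hbounds.2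

theorem treeFace_nonempty (hα : StrictMono α) (T : SBTree n) : (treeFace α T).Nonempty :=
  T.exists_binary_le.elim fun _ hU => ⟨_, (lodayVertex_mem_treeFace hα).mpr hU⟩

theorem treeFace_subset_iff (hα : StrictMono α) {T S : SBTree n} :
    treeFace α T ⊆ treeFace α S ↔ T ≤ S := by
  constructor
  · refine fun h => SBTree.le_iff.mpr fun a b hS => ?_
    have hbounds := SBTree.bounds_of_isBracket hS
    by_contra hT
    obtain ⟨U, hUT, hU⟩ := T.exists_binary_le_avoiding hbounds.1 hbounds.2 hT
    have hUS := (lodayVertex_mem_treeFace hα).mp (h ((lodayVertex_mem_treeFace hα).mpr hUT))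
    exact hU (SBTree.le_iff.mp hUS a b hS)
  · exact fun h x hx => ⟨hx.1, fun a b hS => hx.2 a b (SBTree.le_iff.mp h a b hS)⟩

/-- The set of maximizers over `P` of the linear functional with coefficients `w`. -/
def maximizers (P : Set (Fin n → ℝ)) (w : Fin n → ℝ) : Set (Fin n → ℝ) :=
  {x ∈ P | ∀ y ∈ P, w ⬝ᵥ y ≤ w ⬝ᵥ x}

theorem isExposed_iff_maximizers {P F : Set (Fin n → ℝ)} :
    IsExposed ℝ P F ↔ (F.Nonempty → ∃ w, F = maximizers P w) :=
  imp_congr_right fun _ => Function.Surjective.exists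
    (f := fun w => (dotProductEquiv ℝ (Fin n) w).toContinuousLinearMap)
    (LinearMap.toContinuousLinearMap.surjective.comp (dotProductEquiv ℝ (Fin n)).surjective)

theorem treeFace_eq_maximizers (hα : StrictMono α) {T : SBTree n} {w : Fin n → ℝ}
    (h : T.IsCartesianTree w) : treeFace α T = maximizers (LodAsso α) w := by
  have hsum : ∀ x ∈ LodAsso α, ∀ y ∈ treeFace α T, ∑ i, (x - y) i = 0 := fun x hx y hy => by
    simp [sum_of_mem_lodAsso hx, sum_of_mem_lodAsso hy.1]
  have hbr : ∀ x ∈ LodAsso α, ∀ y ∈ treeFace α T, ∀ a b, IsBracket [T.1] 0 a b →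
      0 ≤ intervalSum a b (x - y) := fun x hx y hy a b hab => by
    have hbounds := SBTree.bounds_of_isBracket hab
    rw [map_sub, hy.2 a b hab, sub_nonneg]
    exact initialSum_le_intervalSum hα hx hbounds.1.le hbounds.2
  have hle : ∀ x ∈ LodAsso α, ∀ y ∈ treeFace α T, w ⬝ᵥ x ≤ w ⬝ᵥ y := fun x hx y hy => by
    simpa [dotProduct_sub] using h.dotProduct_nonpos (hsum x hx y hy) (hbr x hx y hy)
  refine Set.Subset.antisymm (fun y hy => ⟨hy.1, fun x hx => hle x hx y hy⟩) ?_
  rintro x ⟨hx, hmax⟩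
  obtain ⟨y, hy⟩ := treeFace_nonempty hα T
  refine ⟨hx, fun a b hab => ?_⟩
  have hwz : w ⬝ᵥ (x - y) = 0 := by
    rw [dotProduct_sub, sub_eq_zero]
    exact (hle x hx y hy).antisymm (hmax y hy.1)
  rw [← hy.2 a b hab, ← sub_eq_zero, ← map_sub]
  exact h.intervalSum_eq_zero (hsum x hx y hy) (hbr x hx y hy) hwz hab

theorem isExposed_treeFace (hα : StrictMono α) (T : SBTree n) :
    IsExposed ℝ (LodAsso α) (treeFace α T) :=
  isExposed_iff_maximizers.mpr fun _ =>
    T.exists_isCartesianTree.imp fun _ hw => treeFace_eq_maximizers hα hw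

theorem exists_eq_treeFace (hα : StrictMono α) {F : Set (Fin n → ℝ)}
    (hF : IsExposed ℝ (LodAsso α) F) (hne : F.Nonempty) : ∃ T : SBTree n, F = treeFace α T := by
  obtain ⟨w, rfl⟩ := isExposed_iff_maximizers.mp hF hne
  exact (SBTree.exists_isCartesianTree_of_vector w).imp fun _ hT =>
    (treeFace_eq_maximizers hα hT).symm

theorem nonempty_facePoset_orderIso (hα : StrictMono α) :
    Nonempty (FacePoset (LodAsso α) ≃o WithBot (SBTree n)) := by
  let f : WithBot (SBTree n) → FacePoset (LodAsso α) :=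
    WithBot.recBotCoe ⟨∅, fun h => absurd h Set.not_nonempty_empty⟩
      fun T => ⟨treeFace α T, isExposed_treeFace hα T⟩
  have hle : ∀ T S, f T ≤ f S ↔ T ≤ S
    | ⊥, _ => iff_of_true (Set.empty_subset _) bot_le
    | (T : SBTree n), ⊥ => iff_of_false
        (fun h => (treeFace_nonempty hα T).ne_empty (Set.subset_empty_iff.mp h)) (by simp)
    | (T : SBTree n), (S : SBTree n) => by
        rw [WithBot.coe_le_coe]
        exact treeFace_subset_iff hα
  have hsurj : f.Surjective := by
    rintro ⟨F, hF⟩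
    rcases F.eq_empty_or_nonempty with rfl | hne
    · exact ⟨⊥, rfl⟩
    · obtain ⟨T, rfl⟩ := exists_eq_treeFace hα hF hne
      exact ⟨T, rfl⟩
  exact ⟨(RelIso.ofSurjective (OrderEmbedding.ofMapLEIff f hle) hsurj).symm⟩

end Faces

/-! ## Vertices, edges and dimension -/

theorem CBTree.eq_of_le {n : ℕ} {T U : CBTree n} (h : T.1 ≤ U.1) : T = U := by
  rcases ContractsTo.eq_or_lt h with h | h
  · exact Subtype.ext (Subtype.ext h)
  · exact absurd (U.2.trans T.2.symm) h.ne

theorem SBTree.eq_zero_and_eq_of_forall_le {n : ℕ} {T : SBTree n} (h : ∀ U : CBTree n, U.1 ≤ T)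
    {a b : ℕ} (hab : IsBracket [T.1] 0 a b) : a = 0 ∧ b = n := by
  -- The Cartesian tree of the zero vector has only one bracket.
  obtain ⟨C, hC⟩ := SBTree.exists_isCartesianTree_of_vector (0 : Fin n → ℝ)
  have hbounds := SBTree.bounds_of_isBracket hab
  have hCab : IsBracket [C.1] 0 a b := by
    by_contra hCab
    obtain ⟨U, -, hU⟩ := C.exists_binary_le_avoiding hbounds.1 hbounds.2 hCab
    exact hU (SBTree.le_iff.mp (h U) a b hab)
  have hno : ∀ j < n, ¬ (j + 1 = a ∨ j = b) := fun j hj hjab => by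
    simpa using (hC.isBracket_iff.mp hCab).lt_boundary a (by simpa using hbounds.1) j
      (by simpa using hj) hjab
  have ha := hno (a - 1)
  have hb := hno b
  omega

section Flip

variable {n : ℕ} {T T' : CBTree n}

theorem CBTree.setOf_le_eq_pair {S : SBTree n} (h : IsFlip T.1.1 T'.1.1 S.1) :
    {U : CBTree n | U.1 ≤ S} = {T, T'} := by
  obtain ⟨hT, hT'⟩ := h.contractsEdge
  refine Set.Subset.antisymm (fun U hU => ?_) ?_
  · obtain ⟨k, hk⟩ := ContractsTo.exists_contractsEdge hU U.isBinary T.isBinary hT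
    obtain ⟨V, V', hV, hUV⟩ := hk.exists_isFlip U.isBinary
    obtain ⟨rfl, rfl⟩ := h.unique hV
    exact hUV.imp (fun h => Subtype.ext (Subtype.ext h.2)) fun h => Subtype.ext (Subtype.ext h.2)
  · rintro U (rfl | rfl)
    · exact Relation.ReflTransGen.single ⟨0, hT⟩
    · exact Relation.ReflTransGen.single ⟨1, hT'⟩

theorem CBTree.exists_setOf_le_of_flip (h : T.Flip T') :
    ∃ S : SBTree n, {U : CBTree n | U.1 ≤ S} = {T, T'} := by
  have key : ∀ {T T' : CBTree n} {S}, ContractsEdge 0 T.1.1 S → ContractsEdge 1 T'.1.1 S →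
      ∃ S : SBTree n, {U : CBTree n | U.1 ≤ S} = {T, T'} := by
    intro T T' S hT hT'
    obtain ⟨A, A', hA, hTA⟩ := hT.exists_isFlip T.isBinary
    obtain ⟨B, B', hB, hTB⟩ := hT'.exists_isFlip T'.isBinary
    obtain ⟨rfl, rfl⟩ := hA.unique hB
    obtain rfl : T.1.1 = A := by simpa using hTA
    obtain rfl : T'.1.1 = A' := by simpa using hTB
    exact ⟨⟨S, hT.strictlyBranching T.1.2.1, hT.numLeaves_eq ▸ T.1.2.2⟩, setOf_le_eq_pair hA⟩
  obtain ⟨S, ⟨hT, hT'⟩ | ⟨hT, hT'⟩⟩ := h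
  · exact key hT hT'
  · rw [Set.pair_comm]
    exact key hT' hT

theorem CBTree.flip_of_setOf_le (hne : T ≠ T') {S : SBTree n}
    (hS : {U : CBTree n | U.1 ≤ S} = {T, T'}) : T.Flip T' := by
  have hT : T.1 ≤ S := hS.ge (Set.mem_insert T _)
  have hT' : T'.1 ≤ S := hS.ge (Set.mem_insert_of_mem T rfl)
  -- `T` lies strictly below `S`, and the first edge contracted on the way from `T` to `S` can
  -- also be restored in the other way, which gives a tree below `S` that must be `T'`.
  obtain hTS | ⟨R, ⟨j, hj⟩, hR⟩ := Relation.ReflTransGen.cases_head hT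
  · obtain rfl : T.1 = S := Subtype.ext hTS
    exact absurd (CBTree.eq_of_le hT').symm hne
  obtain ⟨A, A', hA, hTA⟩ := hj.exists_isFlip T.isBinary
  have hother : ∀ {V k}, V.IsBinary → V ≠ T.1.1 → ContractsEdge k V R → V = T'.1.1 := by
    intro V k hV hVT hk
    obtain ⟨V, rfl⟩ := CBTree.exists_eq hV
      (hk.numLeaves_eq.trans (hj.numLeaves_eq.symm.trans T.1.2.2))
    rcases hS.le (show V.1 ≤ S from hR.head ⟨k, hk⟩) with rfl | rfl
    · exact absurd rfl hVT
    · rfl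
  obtain ⟨hA0, hA1⟩ := hA.contractsEdge
  rcases hTA with ⟨-, rfl⟩ | ⟨-, rfl⟩
  · obtain rfl := hother hA.isBinary.2 hA.ne.symm hA1
    exact ⟨R, Or.inl ⟨hA0, hA1⟩⟩
  · obtain rfl := hother hA.isBinary.1 hA.ne hA0
    exact ⟨R, Or.inr ⟨hA1, hA0⟩⟩

theorem CBTree.flip_iff (hne : T ≠ T') :
    T.Flip T' ↔ ∃ S : SBTree n, {U : CBTree n | U.1 ≤ S} = {T, T'} :=
  ⟨exists_setOf_le_of_flip, fun ⟨_, hS⟩ => flip_of_setOf_le hne hS⟩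

end Flip

instance (n : ℕ) : Finite (SBTree n) := by
  let brackets (T : SBTree n) : Set (Fin (n + 1) × Fin (n + 1)) :=
    {q | IsBracket [T.1] 0 q.1 q.2}
  have hle : ∀ {T S}, brackets S ⊆ brackets T → T ≤ S := fun {T S} h =>
    SBTree.le_iff.mpr fun a b hab => by
      have hbounds := SBTree.bounds_of_isBracket hab
      exact @h (⟨a, by omega⟩, ⟨b, by omega⟩) hab
  exact Finite.of_injective brackets fun T S h => le_antisymm (hle h.ge) (hle h.le)

theorem finite_range_lodayVertex {n : ℕ} (α : Fin n → ℝ) : (Set.range (lodayVertex α)).Finite :=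
  have : Finite (CBTree n) := Subtype.finite
  Set.finite_range _

theorem isExposed_convexHull_eq {E : Type*} [AddCommGroup E] [Module ℝ E] [TopologicalSpace E]
    [IsTopologicalAddGroup E] [ContinuousSMul ℝ E] [T2Space E] [LocallyConvexSpace ℝ E]
    {s F : Set E} (hs : s.Finite) (hF : IsExposed ℝ (convexHull ℝ s) F) :
    F = convexHull ℝ (F ∩ s) := by
  have hconv : Convex ℝ F := hF.convex (convex_convexHull ℝ s)
  refine Set.Subset.antisymm ?_ (convexHull_min Set.inter_subset_left hconv)
  have hsub : F.extremePoints ℝ ⊆ F ∩ s := fun x hx => ⟨hx.1,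
    extremePoints_convexHull_subset (hF.isExtreme.extremePoints_subset_extremePoints hx)⟩
  calc F = closure (convexHull ℝ (F.extremePoints ℝ)) := Eq.symm <|
        closure_convexHull_extremePoints (hF.isCompact (hs.isCompact_convexHull ℝ)) hconv
    _ ⊆ convexHull ℝ (F ∩ s) := closure_minimal (convexHull_mono hsub)
        ((hs.inter_of_right F).isClosed_convexHull ℝ)

section Vertices

variable {n : ℕ} {α : Fin n → ℝ}

theorem lodayVertex_injective (hα : StrictMono α) : Function.Injective (lodayVertex α) :=
  fun _ _ h => CBTree.eq_of_le <| (lodayVertex_mem_treeFace hα).mp <|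
    h ▸ (lodayVertex_mem_treeFace hα).mpr le_rfl

theorem treeFace_eq_convexHull (hα : StrictMono α) (T : SBTree n) :
    treeFace α T = convexHull ℝ (lodayVertex α '' {U | U.1 ≤ T}) := by
  rw [isExposed_convexHull_eq (finite_range_lodayVertex α) (isExposed_treeFace hα T),
    Set.inter_comm, ← Set.image_preimage_eq_range_inter]
  simp only [Set.preimage, lodayVertex_mem_treeFace hα]

theorem treeFace_eq_singleton (hα : StrictMono α) (T : CBTree n) :
    treeFace α T.1 = {lodayVertex α T} := by
  have hT : {U : CBTree n | U.1 ≤ T.1} = {T} :=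
    Set.ext fun U => ⟨CBTree.eq_of_le, fun h => (congrArg Subtype.val h).le⟩
  rw [treeFace_eq_convexHull hα, hT, Set.image_singleton, convexHull_singleton]

theorem exposedPoints_lodAsso (hα : StrictMono α) :
    (LodAsso α).exposedPoints ℝ = Set.range (lodayVertex α) := by
  ext x
  rw [mem_exposedPoints_iff_exposed_singleton]
  constructor
  · intro h
    obtain ⟨T, hT⟩ := exists_eq_treeFace hα h (Set.singleton_nonempty x)
    obtain ⟨U, hU⟩ := T.exists_binary_le
    exact ⟨U, hT.ge ((lodayVertex_mem_treeFace hα).mpr hU)⟩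
  · rintro ⟨T, rfl⟩
    rw [← treeFace_eq_singleton hα]
    exact isExposed_treeFace hα T.1

theorem setOf_le_eq_pair_of_segment (hα : StrictMono α) {T T' : CBTree n} {S : SBTree n}
    (hS : segment ℝ (lodayVertex α T) (lodayVertex α T') = treeFace α S) :
    {U : CBTree n | U.1 ≤ S} = {T, T'} := by
  have hinj := lodayVertex_injective hα
  refine Set.ext fun U => ?_
  rw [Set.mem_ofPred_eq, ← lodayVertex_mem_treeFace hα, ← hS]
  constructor
  · intro hU
    have hext : lodayVertex α U ∈ (LodAsso α).extremePoints ℝ :=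
      exposedPoints_subset_extremePoints ((exposedPoints_lodAsso hα).ge ⟨U, rfl⟩)
    exact ((mem_extremePoints_iff_forall_segment.mp hext).2 _ (lodayVertex_mem_lodAsso α T) _
      (lodayVertex_mem_lodAsso α T') hU).imp (fun h => hinj h.symm) fun h => hinj h.symm
  · rintro (rfl | rfl)
    · exact left_mem_segment ℝ _ _
    · exact right_mem_segment ℝ _ _

theorem isExposed_segment_iff_flip (hα : StrictMono α) {T T' : CBTree n} (hne : T ≠ T') :
    IsExposed ℝ (LodAsso α) (segment ℝ (lodayVertex α T) (lodayVertex α T')) ↔ T.Flip T' := by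
  rw [CBTree.flip_iff hne]
  constructor
  · intro h
    exact (exists_eq_treeFace hα h ⟨_, left_mem_segment ℝ _ _⟩).imp fun S =>
      setOf_le_eq_pair_of_segment hα
  · rintro ⟨S, hS⟩
    rw [← convexHull_pair, ← Set.image_pair, ← hS, ← treeFace_eq_convexHull hα]
    exact isExposed_treeFace hα S

end Vertices

section Dimension

variable {n d : ℕ}

theorem eq_of_dotProduct_const {α : Fin n → ℝ} (hα : StrictMono α) {w : Fin n → ℝ}
    (hw : ∀ x ∈ LodAsso α, ∀ y ∈ LodAsso α, w ⬝ᵥ x = w ⬝ᵥ y) (i j : Fin n) : w i = w j := by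
  obtain ⟨T, hT⟩ := SBTree.exists_isCartesianTree_of_vector w
  have hall (U : CBTree n) : U.1 ≤ T := by
    rw [← lodayVertex_mem_treeFace hα, treeFace_eq_maximizers hα hT]
    have hU := lodayVertex_mem_lodAsso α U
    exact ⟨hU, fun y hy => (hw y hy _ hU).le⟩
  have hle (i j : Fin n) : w i ≤ w j := by
    have hsum : ∑ k, (Pi.single i 1 - Pi.single j 1 : Fin n → ℝ) k = 0 := by simp
    have h := hT.dotProduct_nonpos hsum fun a b hab => by
      obtain ⟨rfl, rfl⟩ := SBTree.eq_zero_and_eq_of_forall_le hall hab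
      rw [intervalSum_zero_self, hsum]
    simpa [dotProduct_sub] using h
  exact (hle i j).antisymm (hle j i)

theorem dualAnnihilator_vectorSpan_lodAsso {α : Fin (d + 1) → ℝ} (hα : StrictMono α) :
    (vectorSpan ℝ (LodAsso α)).dualAnnihilator =
      Submodule.span ℝ {dotProductEquiv ℝ (Fin (d + 1)) 1} := by
  refine le_antisymm (fun φ hφ => ?_) ((Submodule.span_singleton_le_iff_mem _ _).mpr ?_)
  · obtain ⟨w, rfl⟩ := (dotProductEquiv ℝ (Fin (d + 1))).surjective φ
    have hconst : ∀ x ∈ LodAsso α, ∀ y ∈ LodAsso α, w ⬝ᵥ x = w ⬝ᵥ y := fun x hx y hy => by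
      simpa [dotProduct_sub, sub_eq_zero] using
        (Submodule.mem_dualAnnihilator _).mp hφ _ (vsub_mem_vectorSpan ℝ hx hy)
    have hw : w = w 0 • 1 := funext fun i => by
      simpa using eq_of_dotProduct_const hα hconst i 0
    rw [hw, map_smul]
    exact Submodule.smul_mem _ _ (Submodule.mem_span_singleton_self _)
  · rw [vectorSpan_def, ← SetLike.mem_coe, Submodule.coe_dualAnnihilator_span]
    rintro _ ⟨x, hx, y, hy, rfl⟩
    simp [one_dotProduct, sum_of_mem_lodAsso hx, sum_of_mem_lodAsso hy]

theorem finrank_vectorSpan_lodAsso {α : Fin (d + 1) → ℝ} (hα : StrictMono α) :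
    Module.finrank ℝ (vectorSpan ℝ (LodAsso α)) = d := by
  have hfinrank := Subspace.finrank_add_finrank_dualAnnihilator_eq (vectorSpan ℝ (LodAsso α))
  rw [dualAnnihilator_vectorSpan_lodAsso hα, finrank_span_singleton (by simp),
    Module.finrank_fin_fun] at hfinrank
  omega

theorem isAssociahedron_lodAsso {α : Fin (d + 1) → ℝ} (hα : StrictMono α) :
    IsAssociahedron d (LodAsso α) :=
  ⟨⟨_, finite_range_lodayVertex α, rfl⟩, finrank_vectorSpan_lodAsso hα,
    (Equiv.ofInjective _ (lodayVertex_injective hα)).trans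
      (Equiv.setCongr (exposedPoints_lodAsso hα).symm),
    fun _ _ hne => isExposed_segment_iff_flip hα hne⟩

end Dimension

/-! ## Normal fans -/

section NormalFan

variable {n : ℕ} {α β : Fin n → ℝ}

theorem isDeformation_of_maximizers {Q P : Set (Fin n → ℝ)} (hP : ∀ w, (maximizers P w).Nonempty)
    (h : ∀ w w', maximizers P w ⊆ maximizers P w' → maximizers Q w ⊆ maximizers Q w') :
    IsDeformation Q P := by
  rintro _ ⟨F, hF, -, rfl⟩
  refine ⟨{D ∈ normalFan P | D ⊆ normalCone F Q}, fun D hD => hD.1, ?_⟩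
  refine Set.Subset.antisymm ?_ (Set.sUnion_subset fun D hD => hD.2)
  rintro _ ⟨w, hw, rfl⟩
  have hexp : IsExposed ℝ P (maximizers P w) := isExposed_iff_maximizers.mpr fun _ => ⟨w, rfl⟩
  refine ⟨normalCone (maximizers P w) P, ⟨⟨_, hexp, hP w, rfl⟩, ?_⟩,
    w, fun y hy => hy.2, rfl⟩
  rintro _ ⟨w', hw', rfl⟩
  have hPw' : maximizers P w ⊆ maximizers P w' := fun y hy => ⟨hy.1, hw' y hy⟩
  exact ⟨w', fun y hy => (h w w' hPw' ⟨hF.subset hy, hw y hy⟩).2, rfl⟩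

theorem le_of_inv_sort_lt {γ : Type*} [LinearOrder γ] {f : Fin n → γ} {i j : Fin n}
    (h : (Tuple.sort f)⁻¹ i < (Tuple.sort f)⁻¹ j) : f i ≤ f j := by
  simpa using Tuple.monotone_sort f h.le

theorem comp_mem_maximizers_permutohedron {w : Fin n → ℝ} {π : Equiv.Perm (Fin n)}
    (h : Monovary w (β ∘ π)) : β ∘ π ∈ maximizers (Permutohedron β) w := by
  refine ⟨subset_convexHull ℝ _ ⟨π, rfl⟩, fun y hy => ?_⟩
  refine convexHull_min ?_ (convex_halfSpace_le (dotProductEquiv ℝ (Fin n) w).isLinear _) hy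
  rintro _ ⟨σ, rfl⟩
  simpa [dotProduct] using h.sum_mul_comp_perm_le_sum_mul (σ := π⁻¹ * σ)

theorem maximizers_permutohedron_nonempty (hβ : StrictMono β) (w : Fin n → ℝ) :
    (maximizers (Permutohedron β) w).Nonempty :=
  ⟨_, comp_mem_maximizers_permutohedron (π := (Tuple.sort w)⁻¹) fun _ _ h =>
    le_of_inv_sort_lt (hβ.lt_iff_lt.mp h)⟩

theorem dotProduct_sub_dotProduct_comp_swap {ι R : Type*} [Fintype ι] [DecidableEq ι] [CommRing R]
    (w x : ι → R) (i j : ι) :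
    w ⬝ᵥ x - w ⬝ᵥ (x ∘ Equiv.swap i j) = (w j - w i) * (x j - x i) := by
  rcases eq_or_ne i j with rfl | hij
  · simp
  have hx : x - x ∘ Equiv.swap i j = (x j - x i) • (Pi.single j 1 - Pi.single i 1) := by
    ext k
    rcases eq_or_ne k i with rfl | hki
    · simp [hij]
    rcases eq_or_ne k j with rfl | hkj
    · simp [hki]
    · simp [Equiv.swap_apply_of_ne_of_ne hki hkj, hki, hkj]
  rw [← dotProduct_sub, hx, dotProduct_smul, dotProduct_sub, dotProduct_single_one,
    dotProduct_single_one, smul_eq_mul, mul_comm]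

theorem le_of_comp_mem_maximizers_permutohedron (hβ : StrictMono β) {w : Fin n → ℝ}
    {π : Equiv.Perm (Fin n)} (h : β ∘ π ∈ maximizers (Permutohedron β) w) {i j : Fin n}
    (hij : π i < π j) : w i ≤ w j := by
  have hswap : w ⬝ᵥ ((β ∘ π) ∘ Equiv.swap i j) ≤ w ⬝ᵥ (β ∘ π) :=
    h.2 _ (subset_convexHull ℝ _ ⟨π * Equiv.swap i j, rfl⟩)
  rw [← sub_nonneg, dotProduct_sub_dotProduct_comp_swap] at hswap
  exact sub_nonneg.mp (nonneg_of_mul_nonneg_left hswap (sub_pos.mpr (hβ hij)))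

theorem le_of_maximizers_permutohedron_subset (hβ : StrictMono β) {w w' : Fin n → ℝ}
    (h : maximizers (Permutohedron β) w ⊆ maximizers (Permutohedron β) w') {i j : Fin n}
    (hij : w i ≤ w j) : w' i ≤ w' j := by
  rcases eq_or_ne i j with rfl | hne
  · rfl
  -- Sort the coordinates by `w`, with `j` last among those of equal weight.
  let f (k : Fin n) : ℝ ×ₗ ℕ := toLex (w k, if k = j then 1 else 0)
  let π := (Tuple.sort f)⁻¹
  have hπ : Monovary w (β ∘ π) := fun a b hab =>
    Prod.Lex.monotone_fst _ _ (le_of_inv_sort_lt (f := f) (hβ.lt_iff_lt.mp hab))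
  have hπij : π i < π j := by
    refine lt_of_not_ge fun hji => ?_
    have hf := le_of_inv_sort_lt (f := f) (hji.lt_of_ne (π.injective.ne hne.symm))
    simp [f, Prod.Lex.toLex_le_toLex, hne, hij.not_gt] at hf
  exact le_of_comp_mem_maximizers_permutohedron hβ (h (comp_mem_maximizers_permutohedron hπ)) hπij

theorem SBTree.IsCartesianTree.le_of_monotone {T T' : SBTree n} {w w' : Fin n → ℝ}
    (hT : T.IsCartesianTree w) (hT' : T'.IsCartesianTree w')
    (h : ∀ i j, w i ≤ w j → w' i ≤ w' j) : T ≤ T' := by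
  refine SBTree.le_iff.mpr fun a b hab => hT.isBracket_iff.mpr ?_
  refine (hT'.isBracket_iff.mp hab).mono fun i hi j hj hij => ?_
  lift i to Fin n using (Finset.mem_Ico.mp hi).2
  lift j to Fin n using (Finset.mem_Ico.mp hj).2
  simp only [extendZero_val] at hij ⊢
  exact lt_imp_lt_of_le_imp_le (h j i) hij

theorem isDeformation_lodAsso (hα : StrictMono α) (hβ : StrictMono β) :
    IsDeformation (LodAsso α) (Permutohedron β) := by
  refine isDeformation_of_maximizers (maximizers_permutohedron_nonempty hβ) fun w w' h => ?_
  obtain ⟨T, hT⟩ := SBTree.exists_isCartesianTree_of_vector w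
  obtain ⟨T', hT'⟩ := SBTree.exists_isCartesianTree_of_vector w'
  rw [← treeFace_eq_maximizers hα hT, ← treeFace_eq_maximizers hα hT', treeFace_subset_iff hα]
  exact hT.le_of_monotone hT' fun i j => le_of_maximizers_permutohedron_subset hβ h

theorem isGeneralizedPermutohedron_lodAsso (hα : StrictMono α) :
    IsGeneralizedPermutohedron (LodAsso α) :=
  ⟨⟨_, finite_range_lodayVertex α, rfl⟩, ⟨initialSum α n, fun _ => sum_of_mem_lodAsso⟩,
    α, hα, isDeformation_lodAsso hα hα⟩

end NormalFan

theorem theorem4p3 (d : ℕ) (α : Fin (d + 1) → ℝ) (hα : StrictMono α) :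
    Nonempty (FacePoset (LodAsso α) ≃o AssoPoset d) ∧
      IsAssociahedron d (LodAsso α) ∧
      IsGeneralizedPermutohedron (LodAsso α) :=
  ⟨nonempty_facePoset_orderIso hα, isAssociahedron_lodAsso hα,
    isGeneralizedPermutohedron_lodAsso hα⟩
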